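/- **Setting.** An observation is $(X,A,Y)$, where $X$ are covariates, $A$ is a real-valued exposure and $Y$ is a real-valued outcome with $E[Y^2]<\infty$. Given $X=x$, $A$ has a conditional Lebesgue density $f(a\mid x)$, $a\in\mathbb R$, which is differentiable in $a$; write $s(a\mid x)=\partial_a f(a\mid x)/f(a\mid x)$. Given $(A,X)=(a,x)$, $Y$ has a conditional Lebesgue density $f(y\mid a,x)$ (so there are no point masses), which is bounded uniformly in $(y,a,x)$. Let $\mu(a,x)=E[Y\mid A=a,X=x]$, assumed differentiable in $a$, let $\mu'=\partial_a\mu$, and let $M(a,x)$ be a conditional median of $Y$ given $(A,X)=(a,x)$. For a sensitivity parameter $\gamma\ge 0$, the bounds on the average derivative effect (ADE) are $$\psi_{\max}=E[-s(A\mid X)Y]+\gamma E[Y(\mathbb 1_{\{Y>M(A,X)\}}-\mathbb 1_{\{Y<M(A,X)\}})],$$ $$\psi_{\min}=E[-s(A\mid X)Y]-\gamma E[Y(\mathbb 1_{\{Y>M(A,X)\}}-\mathbb 1_{\{Y<M(A,X)\}})].$$ For $\eta=(\mu,\mu',s,M)$ their (uncentered) efficient influence functions are $$\phi_{\max}(\eta)=\mu'(A,X)-s(A\mid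 X)\{Y-\mu(A,X)\}+\gamma(Y-M(A,X))(\mathbb 1_{\{Y>M(A,X)\}}-\mathbb 1_{\{Y<M(A,X)\}}),$$ and $\phi_{\min}(\eta)$, which is the same expression with $-\gamma$ in place of $+\gamma$. **Estimators.** Let $(X_i,A_i,Y_i)_{i\ge1}$ be i.i.d. copies of $(X,A,Y)$. For each $n$, let $\widehat\eta=\widehat\eta_n=(\widehat\mu,\widehat\mu',\widehat s,\widehat M)$ be nuisance estimates computed from training data independent of $(X_i,A_i,Y_i)_{i\le n}$, where $\widehat\mu$ is differentiable in $a$ and $\widehat\mu'=\partial_a\widehat\mu$. The sample-split one-step estimators $\widehat\psi_{\max}$ and $\widehat\psi_{\min}$ are the averages of $\phi_{\max}(\widehat\eta)$ and $\phi_{\min}(\widehat\eta)$ over the observations $i=1,\dots,n$. **Theorem.** Assume that $\mu,\mu',s,M$, evaluated at $(A,X)$, are almost surely bounded, that $\widehat\mu,\widehat\mu',\widehat s,\widehat M$, evaluated at $(A,X)$, are almost surely bounded by a constant that does not depend on $n$, and that $$\|\widehat\mu-\mu\|+\|\widehat\mu'-\mu'\|+\|\widehat s-s\|+\|\widehat M-M\|=o_p(n^{-1/4}),$$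 where $\|\cdot\|$ is the $L_2$ norm under the law of $(A,X)$ with the training data held fixed. Then, as $n\to\infty$, $$\sqrt n(\widehat\psi_{\max}-\psi_{\max})\xrightarrow{d}N(0,\mathrm{Var}(\phi_{\max}(\eta))),\qquad \sqrt n(\widehat\psi_{\min}-\psi_{\min})\xrightarrow{d}N(0,\mathrm{Var}(\phi_{\min}(\eta))).$$ -/

import Mathlib

open MeasureTheory ProbabilityTheory Filter Topology
open scoped ENNReal

namespace ADE

/-- One observation `(X, A, Y)`: covariates, real exposure, real outcome. -/
abbrev Obs (𝒳 : Type*) := 𝒳 × ℝ × ℝ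

/-- The covariates `X`. -/
def cov {𝒳 : Type*} (z : Obs 𝒳) : 𝒳 := z.1

/-- The exposure `A`. -/
def expo {𝒳 : Type*} (z : Obs 𝒳) : ℝ := z.2.1

/-- The outcome `Y`. -/
def outc {𝒳 : Type*} (z : Obs 𝒳) : ℝ := z.2.2

/-- The pair `(A, X)`. -/
def expoCov {𝒳 : Type*} (z : Obs 𝒳) : ℝ × 𝒳 := (expo z, cov z)

/-- The conditional law of `A` given `X` under the law `Q` of an observation. -/
noncomputable def lawExpo {𝒳 : Type*} [MeasurableSpace 𝒳] (Q : Measure (Obs 𝒳))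
    [IsProbabilityMeasure Q] : Kernel 𝒳 ℝ :=
  condDistrib expo cov Q

/-- The conditional law of `Y` given `(A, X)` under the law `Q` of an observation. -/
noncomputable def lawOutc {𝒳 : Type*} [MeasurableSpace 𝒳] (Q : Measure (Obs 𝒳))
    [IsProbabilityMeasure Q] : Kernel (ℝ × 𝒳) ℝ :=
  condDistrib outc expoCov Q

/-- `f a x` is a version of the conditional Lebesgue density `f(a ∣ x)` of `A` given `X = x`. -/
structure IsExposureDensity {𝒳 : Type*} [MeasurableSpace 𝒳] (Q : Measure (Obs 𝒳))
    [IsProbabilityMeasure Q] (f : ℝ → 𝒳 → ℝ) : Prop where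
  measurable : Measurable (fun p : ℝ × 𝒳 => f p.1 p.2)
  nonneg : ∀ a x, 0 ≤ f a x
  density : ∀ᵐ x ∂(Q.map cov),
    lawExpo Q x = volume.withDensity (fun a => ENNReal.ofReal (f a x))

/-- `g y a x` is a version of the conditional Lebesgue density `f(y ∣ a, x)` of `Y` given
`A = a`, `X = x`. (In particular this conditional law has no point masses.) -/
structure IsOutcomeDensity {𝒳 : Type*} [MeasurableSpace 𝒳] (Q : Measure (Obs 𝒳))
    [IsProbabilityMeasure Q] (g : ℝ → ℝ → 𝒳 → ℝ) : Prop where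
  measurable : Measurable (fun p : ℝ × ℝ × 𝒳 => g p.1 p.2.1 p.2.2)
  nonneg : ∀ y a x, 0 ≤ g y a x
  density : ∀ᵐ p ∂(Q.map expoCov),
    lawOutc Q p = volume.withDensity (fun y => ENNReal.ofReal (g y p.1 p.2))

/-- `μ a x` is a version of the regression function `E[Y ∣ A = a, X = x]`. -/
structure IsCondMean {𝒳 : Type*} [MeasurableSpace 𝒳] (Q : Measure (Obs 𝒳))
    [IsProbabilityMeasure Q] (μ : ℝ → 𝒳 → ℝ) : Prop where
  measurable : Measurable (fun p : ℝ × 𝒳 => μ p.1 p.2)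
  mean : ∀ᵐ p ∂(Q.map expoCov), μ p.1 p.2 = ∫ y, y ∂(lawOutc Q p)

/-- `M a x` is a version of the conditional median of `Y` given `A = a`, `X = x`. -/
structure IsCondMedian {𝒳 : Type*} [MeasurableSpace 𝒳] (Q : Measure (Obs 𝒳))
    [IsProbabilityMeasure Q] (M : ℝ → 𝒳 → ℝ) : Prop where
  measurable : Measurable (fun p : ℝ × 𝒳 => M p.1 p.2)
  median : ∀ᵐ p ∂(Q.map expoCov),
    1 / 2 ≤ lawOutc Q p (Set.Iic (M p.1 p.2)) ∧ 1 / 2 ≤ lawOutc Q p (Set.Ici (M p.1 p.2))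

/-- The score `s(a ∣ x) = ∂ₐ f(a ∣ x) / f(a ∣ x)`. -/
noncomputable def score {𝒳 : Type*} (f : ℝ → 𝒳 → ℝ) (a : ℝ) (x : 𝒳) : ℝ :=
  deriv (fun t => f t x) a / f a x

/-- A (true or estimated) value of the nuisances `(μ, μ', s, M)`, as functions of `(a, x)`.
The entry `μ' = ∂ₐ μ` is determined by `μ`, see `Nuisance.dmu`. -/
structure Nuisance (𝒳 : Type*) where
  mu : ℝ → 𝒳 → ℝ
  s : ℝ → 𝒳 → ℝ
  M : ℝ → 𝒳 → ℝ

/-- `μ'(a, x) = ∂ₐ μ(a, x)`. -/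
noncomputable def Nuisance.dmu {𝒳 : Type*} (η : Nuisance 𝒳) (a : ℝ) (x : 𝒳) : ℝ :=
  deriv (fun t => η.mu t x) a

/-- `1{y > m} - 1{y < m}`. -/
noncomputable def side (y m : ℝ) : ℝ :=
  (Set.Ioi m).indicator 1 y - (Set.Iio m).indicator 1 y

/-- The uncentered efficient influence function of the upper bound, at nuisance value `η`. -/
noncomputable def phiMax {𝒳 : Type*} (γ : ℝ) (η : Nuisance 𝒳) (z : Obs 𝒳) : ℝ :=
  η.dmu (expo z) (cov z) - η.s (expo z) (cov z) * (outc z - η.mu (expo z) (cov z))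
    + γ * ((outc z - η.M (expo z) (cov z)) * side (outc z) (η.M (expo z) (cov z)))

/-- The uncentered efficient influence function of the lower bound, at nuisance value `η`. -/
noncomputable def phiMin {𝒳 : Type*} (γ : ℝ) (η : Nuisance 𝒳) (z : Obs 𝒳) : ℝ :=
  η.dmu (expo z) (cov z) - η.s (expo z) (cov z) * (outc z - η.mu (expo z) (cov z))
    - γ * ((outc z - η.M (expo z) (cov z)) * side (outc z) (η.M (expo z) (cov z)))

/-- The upper bound `ψ_max = E[-s(A ∣ X) Y] + γ E[Y (1{Y > M(A,X)} - 1{Y < M(A,X)})]`. -/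
noncomputable def psiMax {𝒳 : Type*} [MeasurableSpace 𝒳] (Q : Measure (Obs 𝒳)) (γ : ℝ)
    (f M : ℝ → 𝒳 → ℝ) : ℝ :=
  (∫ z, -score f (expo z) (cov z) * outc z ∂Q)
    + γ * ∫ z, outc z * side (outc z) (M (expo z) (cov z)) ∂Q

/-- The lower bound `ψ_min = E[-s(A ∣ X) Y] - γ E[Y (1{Y > M(A,X)} - 1{Y < M(A,X)})]`. -/
noncomputable def psiMin {𝒳 : Type*} [MeasurableSpace 𝒳] (Q : Measure (Obs 𝒳)) (γ : ℝ)
    (f M : ℝ → 𝒳 → ℝ) : ℝ :=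
  (∫ z, -score f (expo z) (cov z) * outc z ∂Q)
    - γ * ∫ z, outc z * side (outc z) (M (expo z) (cov z)) ∂Q

/-- The one-step estimator of the upper bound: average over the evaluation sample
`z 0, …, z (n - 1)` of the influence function with estimated nuisances plugged in. -/
noncomputable def psiHatMax {𝒳 : Type*} (γ : ℝ) (n : ℕ) (η : Nuisance 𝒳) (z : ℕ → Obs 𝒳) : ℝ :=
  (1 / (n : ℝ)) * ∑ i ∈ Finset.range n, phiMax γ η (z i)

/-- The one-step estimator of the lower bound. -/
noncomputable def psiHatMin {𝒳 : Type*} (γ : ℝ) (n : ℕ) (η : Nuisance 𝒳) (z : ℕ → Obs 𝒳) : ℝ :=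
  (1 / (n : ℝ)) * ∑ i ∈ Finset.range n, phiMin γ η (z i)

/-- `μ(A,X)`, `μ'(A,X)`, `s(A ∣ X)`, `M(A,X)` are bounded by `C` almost surely. -/
def Nuisance.BoundedBy {𝒳 : Type*} [MeasurableSpace 𝒳] (η : Nuisance 𝒳) (Q : Measure (Obs 𝒳))
    (C : ℝ) : Prop :=
  ∀ᵐ z ∂Q, |η.mu (expo z) (cov z)| ≤ C ∧ |η.dmu (expo z) (cov z)| ≤ C ∧
    |η.s (expo z) (cov z)| ≤ C ∧ |η.M (expo z) (cov z)| ≤ C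

/-- The `L²(Q)` distance between two functions of `(A, X)`. -/
noncomputable def l2Dist {𝒳 : Type*} [MeasurableSpace 𝒳] (Q : Measure (Obs 𝒳))
    (g h : ℝ → 𝒳 → ℝ) : ℝ≥0∞ :=
  eLpNorm (fun z => g (expo z) (cov z) - h (expo z) (cov z)) 2 Q

/-- The total error `‖μ̂ - μ‖ + ‖μ̂' - μ'‖ + ‖ŝ - s‖ + ‖M̂ - M‖`. -/
noncomputable def Nuisance.error {𝒳 : Type*} [MeasurableSpace 𝒳] (Q : Measure (Obs 𝒳))
    (ηhat η : Nuisance 𝒳) : ℝ≥0∞ :=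
  l2Dist Q ηhat.mu η.mu + l2Dist Q ηhat.dmu η.dmu + l2Dist Q ηhat.s η.s + l2Dist Q ηhat.M η.M

/-- `R n = o_p(n ^ (-r))`. -/
def IsLittleOP {Ω : Type*} [MeasurableSpace Ω] (P : Measure Ω) (R : ℕ → Ω → ℝ≥0∞)
    (r : ℝ) : Prop :=
  ∀ ε : ℝ≥0∞, 0 < ε →
    Tendsto (fun n : ℕ => P {ω | ε ≤ ENNReal.ofReal ((n : ℝ) ^ r) * R n ω}) atTop (𝓝 0)

/-- A learning procedure, mapping a training data set in `𝒯` to nuisance estimates, whose outputs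
are jointly measurable in the training data and `(a, x)`, with `μ̂` differentiable in `a`. -/
structure IsLearner {𝒳 𝒯 : Type*} [MeasurableSpace 𝒳] [MeasurableSpace 𝒯]
    (ηhat : 𝒯 → Nuisance 𝒳) : Prop where
  measurable_mu : Measurable (fun p : 𝒯 × ℝ × 𝒳 => (ηhat p.1).mu p.2.1 p.2.2)
  measurable_s : Measurable (fun p : 𝒯 × ℝ × 𝒳 => (ηhat p.1).s p.2.1 p.2.2)
  measurable_M : Measurable (fun p : 𝒯 × ℝ × 𝒳 => (ηhat p.1).M p.2.1 p.2.2)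
  differentiable_mu : ∀ t x, Differentiable ℝ (fun a => (ηhat t).mu a x)

end ADE

/-! Write `φ = φ_max(η)` and `φ̂ = φ_max(η̂)`. The scaled error of the estimator is the sum of the
centered normalized average of `φ`, the same expression for `φ̂ - φ`, and √n times the conditional
bias `∫ φ̂ dQ - ∫ φ dQ`. The first term obeys the central limit theorem; the other two vanish in
probability, so Slutsky's lemma concludes (`tendstoInDistribution_sampleSplit`).

The middle term needs only `φ̂ → φ` in L² in probability. Once the training data are fixed, `φ̂ - φ`
is a fixed function averaged over an independent sample, and Chebyshev's inequality applies
(`measure_split_le`). The L² convergence follows from that of the nuisances; the one delicate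
product is `(ŝ - s) Y`, where Y is unbounded, and it is handled by truncating Y (`sq_phiMax_sub_le`,
`tendsto_lintegral_tail`).

The bias is of second order. Integration by parts in the exposure gives `E[μ̂' + s μ̂] = 0`, and
conditioning replaces Y by μ against functions of (A, X), so the regression part leaves only `E[(ŝ -
s)(μ̂ - μ)]`. The sensitivity part is `γ E[|Y - M̂| - |Y - M|]`: a median minimizes the expected
absolute deviation, so its first-order term vanishes, and a bounded outcome density makes the
remainder quadratic in `M̂ - M`. Hence the bias is at most a constant times the squared nuisance
error (`abs_integral_phiMax_sub_psiMax_le`), which is `o_p(n^{-1/2})`.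

The lower bound is the upper bound with γ replaced by -γ. -/

namespace ADE

/-! ### Measurability of derivatives; sample splitting. -/

/-- The derivative of a jointly measurable function in its last, real, variable is jointly
measurable. -/
lemma measurable_deriv_param {α : Type*} [MeasurableSpace α] {h : α → ℝ → ℝ}
    (hh : Measurable (fun p : α × ℝ => h p.1 p.2)) (hd : ∀ x, Differentiable ℝ (h x)) :
    Measurable (fun p : α × ℝ => deriv (h p.1) p.2) := by
  -- The derivative is the pointwise limit of the difference quotients with increment `1 / (n + 1)`,
  -- each jointly measurable.
  refine measurable_of_tendsto_metrizable (f := fun (n : ℕ) (p : α × ℝ) =>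
    ((1 : ℝ) / (n + 1))⁻¹ * (h p.1 (p.2 + 1 / (n + 1)) - h p.1 p.2)) (fun n => ?_) ?_
  · have : Measurable (fun p : α × ℝ => h p.1 (p.2 + 1 / (n + 1))) :=
      hh.comp (g := fun p : α × ℝ => h p.1 p.2)
        (f := fun p : α × ℝ => (p.1, p.2 + (1 : ℝ) / (n + 1))) (by fun_prop)
    exact (this.sub hh).const_mul _
  · refine tendsto_pi_nhds.2 fun p => ?_
    have h1 := (hd p.1 p.2).hasDerivAt.tendsto_slope_zero
    have h2 : Tendsto (fun n : ℕ => (1 : ℝ) / (n + 1)) atTop (𝓝[≠] 0) :=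
      tendsto_nhdsWithin_iff.2 ⟨tendsto_one_div_add_atTop_nhds_zero_nat,
        Eventually.of_forall fun n => by
          simp only [Set.mem_compl_iff, Set.mem_singleton_iff]; positivity⟩
    simpa [Function.comp_def] using h1.comp h2

/-- Chebyshev's inequality for a normalized sum over a product space. -/
lemma pi_chebyshev {𝒵 : Type*} [MeasurableSpace 𝒵] (Q : Measure 𝒵) [IsProbabilityMeasure Q]
    (n : ℕ) {d : 𝒵 → ℝ} (hd : MemLp d 2 Q) {δ : ℝ} (hδ : 0 < δ) :
    Measure.pi (fun _ : Fin n => Q)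
        {z | δ ≤ |(√(n : ℝ))⁻¹ * (∑ i, d (z i) - n * ∫ x, d x ∂Q)|} ≤
      (∫⁻ x, ENNReal.ofReal (d x ^ 2) ∂Q) / ENNReal.ofReal (δ ^ 2) := by
  -- For `n = 0` the normalized sum is 0, and the event `δ ≤ 0` is empty.
  rcases Nat.eq_zero_or_pos n with rfl | hn
  · simp [hδ.not_ge]
  have hn' : (0 : ℝ) < n := by exact_mod_cast hn
  set S : (Fin n → 𝒵) → ℝ := ∑ i, fun z => d (z i) with hS
  have hmem (i : Fin n) :
      MemLp (fun z : Fin n → 𝒵 => d (z i)) 2 (Measure.pi fun _ : Fin n => Q) :=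
    hd.comp_measurePreserving (measurePreserving_eval (fun _ : Fin n => Q) i)
  have hSm : MemLp S 2 (Measure.pi fun _ : Fin n => Q) := memLp_finsetSum' _ fun i _ => hmem i
  have hmean : ∫ z, S z ∂(Measure.pi fun _ : Fin n => Q) = n * ∫ x, d x ∂Q := by
    simp only [hS, Finset.sum_apply]
    rw [integral_finsetSum _ fun i _ => (hmem i).integrable one_le_two]
    have (i : Fin n) : ∫ z : Fin n → 𝒵, d (z i) ∂(Measure.pi fun _ : Fin n => Q)
        = ∫ x, d x ∂Q := by
      have hp := measurePreserving_eval (fun _ : Fin n => Q) i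
      rw [← hp.map_eq, integral_map hp.measurable.aemeasurable]
      · simp [hp.map_eq]
      · rw [hp.map_eq]; exact hd.1
    simp [this]
  have hvar : Var[S; Measure.pi fun _ : Fin n => Q] = n * Var[d; Q] := by
    rw [hS, variance_sum_pi (X := fun _ : Fin n => d) fun _ => hd]
    simp
  have hsub : {z : Fin n → 𝒵 | δ ≤ |(√(n : ℝ))⁻¹ * (∑ i, d (z i) - n * ∫ x, d x ∂Q)|} ⊆
      {z | δ * √n ≤ |S z - ∫ z, S z ∂(Measure.pi fun _ : Fin n => Q)|} := by
    intro z hz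
    rw [Set.mem_ofPred_eq] at hz ⊢
    rw [hmean, hS, Finset.sum_apply]
    rw [abs_mul, abs_of_nonneg (inv_nonneg.2 (Real.sqrt_nonneg _))] at hz
    rwa [inv_mul_eq_div, le_div_iff₀ (Real.sqrt_pos.2 hn')] at hz
  refine (measure_mono hsub).trans
    ((meas_ge_le_variance_div_sq hSm (by positivity)).trans ?_)
  rw [hvar, mul_pow, Real.sq_sqrt hn'.le,
    show (n : ℝ) * Var[d; Q] / (δ ^ 2 * n) = Var[d; Q] / δ ^ 2 by field_simp,
    ENNReal.ofReal_div_of_pos (by positivity)]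
  gcongr
  rw [← ofReal_integral_eq_lintegral_ofReal hd.integrable_sq
    (Eventually.of_forall fun _ => sq_nonneg _)]
  -- The variance is bounded by the second moment because only the L² size of `d` is controlled
  -- later.
  exact ENNReal.ofReal_le_ofReal (variance_le_expectation_sq hd.1)

variable {𝒵 Ω : Type*} [MeasurableSpace 𝒵] [MeasurableSpace Ω]
  {P : Measure Ω} [IsProbabilityMeasure P] {Q : Measure 𝒵}

lemma memLp_two_of_lintegral_sq_lt_top {d : 𝒵 → ℝ} (hd : AEStronglyMeasurable d Q)
    (h : ∫⁻ x, ENNReal.ofReal (d x ^ 2) ∂Q ≠ ∞) : MemLp d 2 Q := by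
  rw [memLp_two_iff_integrable_sq hd]
  exact (lintegral_ofReal_ne_top_iff_integrable (hd.pow 2)
    (Eventually.of_forall fun _ => sq_nonneg _)).1 h

variable [IsProbabilityMeasure Q]

/-- The conditional Chebyshev inequality for the empirical process at a random function that is
independent of the sample. -/
lemma measure_split_le {𝒯 : Type*} [MeasurableSpace 𝒯] {n : ℕ}
    {Z : ℕ → Ω → 𝒵} (hZ_law : ∀ i, HasLaw (Z i) Q P) (hZ_indep : iIndepFun Z P)
    {W : Ω → 𝒯} (hW : AEMeasurable W P)
    (hW_indep : IndepFun W (fun ω (i : Fin n) => Z i ω) P)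
    {d : 𝒯 → 𝒵 → ℝ} (hd : Measurable (fun p : 𝒯 × 𝒵 => d p.1 p.2))
    {ε : ℝ≥0∞} (hε : ε ≠ ∞) {δ : ℝ} (hδ : 0 < δ) :
    P {ω | ∫⁻ x, ENNReal.ofReal (d (W ω) x ^ 2) ∂Q ≤ ε ∧
        δ ≤ |(√(n : ℝ))⁻¹ * (∑ i : Fin n, d (W ω) (Z i ω) - n * ∫ x, d (W ω) x ∂Q)|} ≤
      ε / ENNReal.ofReal (δ ^ 2) := by
  set V : 𝒯 → ℝ≥0∞ := fun t => ∫⁻ x, ENNReal.ofReal (d t x ^ 2) ∂Q with hV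
  have hVm : Measurable V := by
    have : Measurable (fun p : 𝒯 × 𝒵 => ENNReal.ofReal (d p.1 p.2 ^ 2)) :=
      (hd.pow_const 2).ennreal_ofReal
    exact this.lintegral_prod_right'
  have hIm : Measurable (fun t => ∫ x, d t x ∂Q) :=
    (hd.stronglyMeasurable.integral_prod_right' (ν := Q)).measurable
  set T : 𝒯 × (Fin n → 𝒵) → ℝ := fun p =>
    (√(n : ℝ))⁻¹ * (∑ i : Fin n, d p.1 (p.2 i) - n * ∫ x, d p.1 x ∂Q) with hT
  have hTm : Measurable T := by
    refine ((Finset.measurable_fun_sum _ fun i _ => ?_).sub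
      ((hIm.comp measurable_fst).const_mul _)).const_mul _
    exact hd.comp (g := fun p : 𝒯 × 𝒵 => d p.1 p.2)
      (f := fun p : 𝒯 × (Fin n → 𝒵) => (p.1, p.2 i)) (by fun_prop)
  set E : Set (𝒯 × (Fin n → 𝒵)) := {p | V p.1 ≤ ε ∧ δ ≤ |T p|} with hE
  have hEm : MeasurableSet E :=
    (measurableSet_le (hVm.comp measurable_fst) measurable_const).inter
      (measurableSet_le measurable_const hTm.abs)
  have hZm : AEMeasurable (fun ω (i : Fin n) => Z i ω) P :=
    aemeasurable_pi_lambda _ fun i => (hZ_law i).aemeasurable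
  have hlawZ : P.map (fun ω (i : Fin n) => Z i ω) = Measure.pi fun _ : Fin n => Q := by
    rw [(iIndepFun_iff_map_fun_eq_pi_map fun i : Fin n => (hZ_law i).aemeasurable).1
      (hZ_indep.precomp Fin.val_injective)]
    simp [(hZ_law _).map_eq]
  have hlaw := (indepFun_iff_map_prod_eq_prod_map_map hW hZm).1 hW_indep
  rw [hlawZ] at hlaw
  have : IsProbabilityMeasure (P.map W) := Measure.isProbabilityMeasure_map hW
  calc P {ω | V (W ω) ≤ ε ∧ δ ≤ |T (W ω, fun i : Fin n => Z i ω)|}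
      = (P.map fun ω => (W ω, fun i : Fin n => Z i ω)) E := by
        rw [Measure.map_apply_of_aemeasurable (hW.prodMk hZm) hEm]; rfl
    _ = ∫⁻ t, Measure.pi (fun _ : Fin n => Q) (Prod.mk t ⁻¹' E) ∂(P.map W) := by
        rw [hlaw, Measure.prod_apply hEm]
    _ ≤ ∫⁻ _, ε / ENNReal.ofReal (δ ^ 2) ∂(P.map W) := by
        refine lintegral_mono fun t => ?_
        -- For fixed training data `t`, the condition `V t ≤ ε` is deterministic: the section of `E`
        -- is either empty or covered by Chebyshev's inequality for the fixed function `d t`.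
        by_cases ht : V t ≤ ε
        · have hdt : MemLp (d t) 2 Q := memLp_two_of_lintegral_sq_lt_top
            (hd.comp measurable_prodMk_left).aestronglyMeasurable (ht.trans_lt hε.lt_top).ne
          have hsub : Prod.mk t ⁻¹' E ⊆
              {z | δ ≤ |(√(n : ℝ))⁻¹ * (∑ i, d t (z i) - n * ∫ x, d t x ∂Q)|} :=
            fun z hz => hz.2
          refine (measure_mono hsub).trans ((pi_chebyshev Q n hdt hδ).trans ?_)
          gcongr
        · have : Prod.mk t ⁻¹' E = ∅ := Set.eq_empty_of_forall_notMem fun z hz => ht hz.1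
          simp [this]
    _ = ε / ENNReal.ofReal (δ ^ 2) := by simp

/-- Asymptotic normality of a sample-split average: if the estimated function `φhat` converges to
`φ` in `L²` in probability and its conditional bias is of smaller order than `1 / √n`, then the
average of `φhat` over the evaluation sample is asymptotically normal, with the asymptotic variance
of the average of `φ`. -/
theorem tendstoInDistribution_sampleSplit
    {Z : ℕ → Ω → 𝒵} (hZ_law : ∀ i, HasLaw (Z i) Q P) (hZ_indep : iIndepFun Z P)
    {𝒯 : ℕ → Type*} [∀ n, MeasurableSpace (𝒯 n)]
    {W : ∀ n, Ω → 𝒯 n} (hW : ∀ n, AEMeasurable (W n) P)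
    (hW_indep : ∀ n, IndepFun (W n) (fun ω (i : Fin n) => Z i ω) P)
    {φ : 𝒵 → ℝ} (hφm : Measurable φ) (hφ : MemLp φ 2 Q)
    {φhat : ∀ n, 𝒯 n → 𝒵 → ℝ} (hφhat : ∀ n, Measurable (fun p : 𝒯 n × 𝒵 => φhat n p.1 p.2))
    (hL2 : ∀ ε : ℝ≥0∞, 0 < ε → Tendsto (fun n => P {ω | ε <
      ∫⁻ x, ENNReal.ofReal ((φhat n (W n ω) x - φ x) ^ 2) ∂Q}) atTop (𝓝 0))
    (hbias : ∀ δ : ℝ, 0 < δ → Tendsto (fun n : ℕ => P {ω | δ ≤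
      |√(n : ℝ) * (∫ x, φhat n (W n ω) x ∂Q - ∫ x, φ x ∂Q)|}) atTop (𝓝 0)) :
    TendstoInDistribution
      (fun (n : ℕ) ω => √(n : ℝ) * ((1 / (n : ℝ)) * ∑ i ∈ Finset.range n, φhat n (W n ω) (Z i ω)
        - ∫ x, φ x ∂Q))
      atTop (id : ℝ → ℝ) (fun _ => P) (gaussianReal 0 (variance φ Q).toNNReal) := by
  have hφZ (i : ℕ) : HasLaw (fun ω => φ (Z i ω)) (Q.map φ) P :=
    HasLaw.fun_comp ⟨hφm.aemeasurable, rfl⟩ (hZ_law i)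
  have hint (i : ℕ) : ∫ ω, φ (Z i ω) ∂P = ∫ x, φ x ∂Q :=
    (hZ_law i).integral_comp hφ.1
  have hvar : Var[fun ω => φ (Z 0 ω); P] = Var[φ; Q] := by
    rw [← (hZ_law 0).map_eq, variance_map (by rw [(hZ_law 0).map_eq]; exact hφm.aemeasurable)
      (hZ_law 0).aemeasurable]
    rfl
  have hclt := tendstoInDistribution_inv_sqrt_mul_sum_sub (P := P)
    (X := fun i ω => φ (Z i ω)) (Y := (id : ℝ → ℝ)) (P' := gaussianReal 0 (variance φ Q).toNNReal)
    (by rw [hvar]; exact HasLaw.id)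
    (by
      have := hφ
      rw [← (hZ_law 0).map_eq] at this
      exact this.comp_of_map (hZ_law 0).aemeasurable)
    (hZ_indep.comp (fun _ => φ) fun _ => hφm)
    (fun i => ⟨(hφZ i).aemeasurable, (hφZ 0).aemeasurable, by
      rw [(hφZ i).map_eq, (hφZ 0).map_eq]⟩)
  simp only [hint] at hclt
  -- Slutsky: it suffices that the difference from the normalized average of the true `φ` tends to 0
  -- in probability.
  refine tendstoInDistribution_of_tendstoInMeasure_sub _ _ hclt ?_ fun n => ?_
  · rw [tendstoInMeasure_iff_norm]
    intro δ hδ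
    simp only [Pi.sub_apply, Pi.zero_apply, sub_zero, Real.norm_eq_abs]
    rw [ENNReal.tendsto_nhds_zero]
    intro ε hε
    set c : ℝ≥0∞ := ENNReal.ofReal ((δ / 2) ^ 2) with hc
    have hc0 : c ≠ 0 := (ENNReal.ofReal_pos.2 (by positivity)).ne'
    have hct : c ≠ ∞ := ENNReal.ofReal_ne_top
    -- Chosen so that the Chebyshev bound `ε₁ / c` equals `min ε 1 / 3`; the minimum with 1 keeps
    -- `ε₁` finite when `ε = ∞`. Three events then share the budget `ε`: a large L² distance, a
    -- large centered sum, a large bias.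
    set ε₁ : ℝ≥0∞ := min ε 1 / 3 * c with hε₁
    have hmt : min ε 1 / 3 ≠ ∞ :=
      ENNReal.div_ne_top ((min_le_right _ _).trans_lt ENNReal.one_lt_top).ne (by simp)
    have hε₁t : ε₁ ≠ ∞ := ENNReal.mul_ne_top hmt hct
    have hε₁0 : 0 < ε₁ := ENNReal.mul_pos
      (ENNReal.div_pos (lt_min hε one_pos).ne' (by simp)).ne' hc0
    have hε3 : 0 < ε / 3 := ENNReal.div_pos hε.ne' (by simp)
    filter_upwards [ENNReal.tendsto_nhds_zero.1 (hL2 ε₁ hε₁0) _ hε3,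
      ENNReal.tendsto_nhds_zero.1 (hbias (δ / 2) (half_pos hδ)) _ hε3] with n hA hC
    have hB := measure_split_le hZ_law hZ_indep (hW n) (hW_indep n)
      (d := fun t x => φhat n t x - φ x)
      ((hφhat n).sub (hφm.comp measurable_snd)) hε₁t (half_pos hδ)
    rw [← hc, hε₁, ENNReal.mul_div_cancel_right hc0 hct, ← hε₁] at hB
    refine (measure_mono (t := ({ω | ε₁ < ∫⁻ x, ENNReal.ofReal ((φhat n (W n ω) x - φ x) ^ 2) ∂Q} ∪
      _) ∪ _) ?_).trans ((measure_union_le _ _).trans (add_le_add ((measure_union_le _ _).trans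
        (add_le_add hA (hB.trans (ENNReal.div_le_div_right (min_le_left ε 1) 3)))) hC)) |>.trans
        (ENNReal.add_thirds ε).le
    intro ω hω
    rw [Set.mem_ofPred_eq] at hω
    by_cases h1 : ε₁ < ∫⁻ x, ENNReal.ofReal ((φhat n (W n ω) x - φ x) ^ 2) ∂Q
    · exact Or.inl (Or.inl h1)
    rw [not_lt] at h1
    -- Off the first event `φhat` differs from `φ` by an L² function, hence is integrable, and the
    -- integral of the difference splits.
    have hd : MemLp (fun x => φhat n (W n ω) x - φ x) 2 Q := memLp_two_of_lintegral_sq_lt_top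
      ((((hφhat n).comp measurable_prodMk_left).sub hφm).aestronglyMeasurable)
      (h1.trans_lt hε₁t.lt_top).ne
    have hdint : ∫ x, (φhat n (W n ω) x - φ x) ∂Q
        = ∫ x, φhat n (W n ω) x ∂Q - ∫ x, φ x ∂Q := by
      have : Integrable (fun x => φhat n (W n ω) x) Q := by
        exact ((hd.integrable one_le_two).add (hφ.integrable one_le_two)).congr
          (Eventually.of_forall fun x => by simp)
      exact integral_sub this (hφ.integrable one_le_two)
    -- The difference is the centered empirical process at `φhat - φ` plus the scaled bias; each
    -- gets `δ / 2`.
    have key : √(n : ℝ) * ((1 / (n : ℝ)) * ∑ i ∈ Finset.range n, φhat n (W n ω) (Z i ω)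
          - ∫ x, φ x ∂Q) - (√(n : ℝ))⁻¹ * (∑ i ∈ Finset.range n, φ (Z i ω) - n * ∫ x, φ x ∂Q)
        = (√(n : ℝ))⁻¹ * (∑ i : Fin n, (φhat n (W n ω) (Z i ω) - φ (Z i ω))
            - n * ∫ x, (φhat n (W n ω) x - φ x) ∂Q)
          + √(n : ℝ) * (∫ x, φhat n (W n ω) x ∂Q - ∫ x, φ x ∂Q) := by
      rw [hdint, Finset.sum_sub_distrib, Fin.sum_univ_eq_sum_range (fun i => φhat n (W n ω) (Z i ω)),
        Fin.sum_univ_eq_sum_range (fun i => φ (Z i ω))]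
      rcases Nat.eq_zero_or_pos n with rfl | hn
      · simp
      have hn' : (0 : ℝ) < n := by exact_mod_cast hn
      have h2 : (n : ℝ) = √n * √n := (Real.mul_self_sqrt hn'.le).symm
      have h3 : √(n : ℝ) ≠ 0 := (Real.sqrt_pos.2 hn').ne'
      generalize √(n : ℝ) = r at h2 h3 ⊢
      rw [h2]
      field_simp
      ring
    rw [key] at hω
    by_contra hcon
    simp only [Set.mem_union, Set.mem_ofPred_eq, not_or, not_and, not_le] at hcon
    have := hcon.1.2 h1
    have := hcon.2
    have := hω.trans (abs_add_le _ _)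
    linarith
  · refine AEMeasurable.const_mul (AEMeasurable.sub_const (AEMeasurable.const_mul
      (Finset.aemeasurable_fun_sum _ fun i _ => ?_) _) _) _
    exact (hφhat n).comp_aemeasurable ((hW n).prodMk (hZ_law i).aemeasurable)

end ADE

/-! ### Moment identities: integration by parts in the exposure, and conditioning on (A, X). -/

namespace ADE

/-- Integration by parts for a density `f`: `∫ (h' + (f' / f) h) f = 0`. -/
lemma integral_deriv_add_logDeriv_mul {f h : ℝ → ℝ} (hf0 : ∀ a, 0 ≤ f a)
    (hf : Differentiable ℝ f) (hfi : Integrable f) (hh : Differentiable ℝ h) {C : ℝ}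
    (hb : ∀ᵐ a, f a ≠ 0 → |h a| ≤ C ∧ |deriv h a| ≤ C ∧ |deriv f a / f a| ≤ C) :
    ∫ a, f a * (deriv h a + deriv f a / f a * h a) = 0 := by
  have hderiv (a : ℝ) :
      HasDerivAt (fun t => h t * f t) (f a * (deriv h a + deriv f a / f a * h a)) a := by
    have h1 := (hh a).hasDerivAt.mul (hf a).hasDerivAt
    refine h1.congr_deriv ?_
    -- A zero of the nonnegative `f` is a minimum, so `f'` vanishes there too and the convention `f'
    -- / 0 = 0` does no harm.
    by_cases ha : f a = 0
    · have : deriv f a = 0 :=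
        IsLocalMin.deriv_eq_zero (Eventually.of_forall fun t => by rw [ha]; exact hf0 t)
      simp [ha, this]
    · field_simp
  -- If `h f` and its derivative are both integrable on the line, the derivative integrates to 0; no
  -- separate boundary condition at infinity is needed.
  refine integral_eq_zero_of_hasDerivAt_of_integrable hderiv ?_ ?_
  · have hm : Measurable fun a => f a * (deriv h a + deriv f a / f a * h a) := by
      have := hf.continuous.measurable
      have := hh.continuous.measurable
      have := measurable_deriv f
      have := measurable_deriv h
      fun_prop
    refine (hfi.const_mul (C + C * C)).mono' hm.aestronglyMeasurable ?_
    filter_upwards [hb] with a ha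
    by_cases hfa : f a = 0
    · simp [hfa]
    obtain ⟨h1, h2, h3⟩ := ha hfa
    have hC : 0 ≤ C := (abs_nonneg _).trans h1
    rw [Real.norm_eq_abs, abs_mul, abs_of_nonneg (hf0 a), mul_comm]
    refine mul_le_mul_of_nonneg_right ((abs_add_le _ _).trans (add_le_add h2 ?_)) (hf0 a)
    rw [abs_mul]
    exact mul_le_mul h3 h1 (abs_nonneg _) hC
  · refine (hfi.const_mul C).mono' (hh.continuous.mul hf.continuous).aestronglyMeasurable ?_
    filter_upwards [hb] with a ha
    by_cases hfa : f a = 0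
    · simp [hfa]
    rw [Real.norm_eq_abs, abs_mul, abs_of_nonneg (hf0 a)]
    exact mul_le_mul_of_nonneg_right (ha hfa).1 (hf0 a)

variable {𝒳 : Type*} [MeasurableSpace 𝒳]

@[fun_prop]
lemma measurable_expo : Measurable (expo : Obs 𝒳 → ℝ) := by unfold expo; fun_prop

@[fun_prop]
lemma measurable_cov : Measurable (cov : Obs 𝒳 → 𝒳) := by unfold cov; fun_prop

@[fun_prop]
lemma measurable_outc : Measurable (outc : Obs 𝒳 → ℝ) := by unfold outc; fun_prop

@[fun_prop]
lemma measurable_expoCov : Measurable (expoCov : Obs 𝒳 → ℝ × 𝒳) := by unfold expoCov; fun_prop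

lemma measurable_uncurry_deriv {h : ℝ → 𝒳 → ℝ} (hh : Measurable fun p : ℝ × 𝒳 => h p.1 p.2)
    (hd : ∀ x, Differentiable ℝ fun a => h a x) :
    Measurable fun p : ℝ × 𝒳 => deriv (fun t => h t p.2) p.1 :=
  (measurable_deriv_param (h := fun x a => h a x) (hh.comp measurable_swap) hd).comp
    measurable_swap

lemma measurable_score {f : ℝ → 𝒳 → ℝ} (hf : Measurable fun p : ℝ × 𝒳 => f p.1 p.2)
    (hd : ∀ x, Differentiable ℝ fun a => f a x) :
    Measurable fun p : ℝ × 𝒳 => score f p.1 p.2 :=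
  (measurable_uncurry_deriv hf hd).div hf

variable {Q : Measure (Obs 𝒳)} [IsProbabilityMeasure Q]

lemma map_cov_compProd_lawExpo :
    Q.map cov ⊗ₘ lawExpo Q = Q.map fun z => (cov z, expo z) :=
  compProd_map_condDistrib measurable_expo.aemeasurable

lemma map_expoCov_compProd_lawOutc :
    Q.map expoCov ⊗ₘ lawOutc Q = Q.map fun z => (expoCov z, outc z) :=
  compProd_map_condDistrib measurable_outc.aemeasurable

lemma lintegral_ofReal_of_isProbabilityMeasure {ν : Measure ℝ} [IsProbabilityMeasure ν]
    {f : ℝ → ℝ} (hν : ν = volume.withDensity fun a => ENNReal.ofReal (f a)) :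
    ∫⁻ a, ENNReal.ofReal (f a) = 1 := by
  have := measure_univ (μ := ν)
  rwa [hν, withDensity_apply _ MeasurableSet.univ, Measure.restrict_univ] at this

instance : IsMarkovKernel (lawExpo Q) := by unfold lawExpo; infer_instance

instance : IsMarkovKernel (lawOutc Q) := by unfold lawOutc; infer_instance

instance : IsProbabilityMeasure (Q.map cov) :=
  Measure.isProbabilityMeasure_map measurable_cov.aemeasurable

instance : IsProbabilityMeasure (Q.map expoCov) :=
  Measure.isProbabilityMeasure_map measurable_expoCov.aemeasurable

/-- Integration by parts in the exposure: `E[h'(A, X) + s(A ∣ X) h(A, X)] = 0`. -/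
lemma integral_deriv_add_score_mul {f : ℝ → 𝒳 → ℝ} (hf : IsExposureDensity Q f)
    (hf_diff : ∀ x, Differentiable ℝ fun a => f a x) {h : ℝ → 𝒳 → ℝ}
    (hh : Measurable fun p : ℝ × 𝒳 => h p.1 p.2)
    (hh_diff : ∀ x, Differentiable ℝ fun a => h a x) {C : ℝ}
    (hb : ∀ᵐ z ∂Q, |h (expo z) (cov z)| ≤ C ∧ |deriv (fun t => h t (cov z)) (expo z)| ≤ C ∧
      |score f (expo z) (cov z)| ≤ C) :
    ∫ z, (deriv (fun t => h t (cov z)) (expo z) + score f (expo z) (cov z) * h (expo z) (cov z)) ∂Q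
      = 0 := by
  have hdm := (measurable_uncurry_deriv hh hh_diff).comp measurable_swap
  have hsm := (measurable_score hf.measurable hf_diff).comp measurable_swap
  have hhm := hh.comp measurable_swap
  simp only [Function.comp_def, Prod.fst_swap, Prod.snd_swap] at hdm hsm hhm
  set k : 𝒳 × ℝ → ℝ := fun p => deriv (fun t => h t p.1) p.2 + score f p.2 p.1 * h p.2 p.1 with hk
  have hkm : Measurable k := hdm.add (hsm.mul hhm)
  have hpair : Measurable fun z : Obs 𝒳 => (cov z, expo z) := by fun_prop
  have hb' : ∀ᵐ p ∂(Q.map cov ⊗ₘ lawExpo Q), |h p.2 p.1| ≤ C ∧ |deriv (fun t => h t p.1) p.2| ≤ C ∧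
      |score f p.2 p.1| ≤ C := by
    rw [map_cov_compProd_lawExpo, ae_map_iff hpair.aemeasurable]
    · exact hb
    · exact (measurableSet_le hhm.abs measurable_const).inter
        ((measurableSet_le hdm.abs measurable_const).inter
          (measurableSet_le hsm.abs measurable_const))
  have hki : Integrable k (Q.map cov ⊗ₘ lawExpo Q) := by
    refine Integrable.of_bound hkm.aestronglyMeasurable (C + C * C) ?_
    filter_upwards [hb'] with p ⟨h1, h2, h3⟩
    have hC : 0 ≤ C := (abs_nonneg _).trans h1
    refine (abs_add_le _ _).trans (add_le_add h2 ?_)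
    rw [abs_mul]
    exact mul_le_mul h3 h1 (abs_nonneg _) hC
  calc ∫ z, k (cov z, expo z) ∂Q
      = ∫ p, k p ∂(Q.map cov ⊗ₘ lawExpo Q) := by
        rw [map_cov_compProd_lawExpo, integral_map hpair.aemeasurable hkm.aestronglyMeasurable]
    _ = ∫ x, ∫ a, k (x, a) ∂(lawExpo Q x) ∂(Q.map cov) := Measure.integral_compProd hki
    _ = ∫ _, 0 ∂(Q.map cov) := by
        refine integral_congr_ae ?_
        filter_upwards [hf.density, Measure.ae_ae_of_ae_compProd hb'] with x hx hbx
        have hfx : Measurable fun a => f a x := (hf_diff x).continuous.measurable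
        have h1 := lintegral_ofReal_of_isProbabilityMeasure hx
        rw [hx] at hbx ⊢
        rw [integral_withDensity_eq_integral_toReal_smul hfx.ennreal_ofReal
          (Eventually.of_forall fun _ => ENNReal.ofReal_lt_top)]
        simp only [ENNReal.toReal_ofReal (hf.nonneg _ x), smul_eq_mul, hk, score]
        refine integral_deriv_add_logDeriv_mul (f := fun a => f a x) (h := fun a => h a x)
          (fun a => hf.nonneg a x) (hf_diff x) ?_ (hh_diff x) (C := C) ?_
        · refine (lintegral_ofReal_ne_top_iff_integrable hfx.aestronglyMeasurable
            (Eventually.of_forall fun a => hf.nonneg a x)).1 ?_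
          simp [h1]
        -- An almost sure statement under the density `f` is a Lebesgue-a.e. statement only where `f
        -- ≠ 0`, which is exactly the form the one-dimensional lemma accepts.
        · rw [ae_withDensity_iff hfx.ennreal_ofReal] at hbx
          filter_upwards [hbx] with a ha hfa
          exact ha (ENNReal.ofReal_pos.2 (lt_of_le_of_ne (hf.nonneg a x) (Ne.symm hfa))).ne'
    _ = 0 := by simp

/-- `E[h(A, X) Y] = E[h(A, X) μ(A, X)]`. -/
lemma integral_mul_outc (hY : MemLp outc 2 Q) {μ : ℝ → 𝒳 → ℝ} (hμ : IsCondMean Q μ)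
    {h : ℝ → 𝒳 → ℝ} (hh : Measurable fun p : ℝ × 𝒳 => h p.1 p.2) {C : ℝ}
    (hb : ∀ᵐ z ∂Q, |h (expo z) (cov z)| ≤ C) :
    ∫ z, h (expo z) (cov z) * outc z ∂Q
      = ∫ z, h (expo z) (cov z) * μ (expo z) (cov z) ∂Q := by
  have hpair : Measurable fun z : Obs 𝒳 => (expoCov z, outc z) := by fun_prop
  set k : (ℝ × 𝒳) × ℝ → ℝ := fun p => h p.1.1 p.1.2 * p.2 with hk
  have hkm : Measurable k := (hh.comp measurable_fst).mul measurable_snd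
  have hki : Integrable k (Q.map expoCov ⊗ₘ lawOutc Q) := by
    rw [map_expoCov_compProd_lawOutc,
      integrable_map_measure hkm.aestronglyMeasurable hpair.aemeasurable]
    exact (hY.integrable one_le_two).bdd_mul
      (hh.comp measurable_expoCov).aestronglyMeasurable hb
  calc ∫ z, k (expoCov z, outc z) ∂Q
      = ∫ p, k p ∂(Q.map expoCov ⊗ₘ lawOutc Q) := by
        rw [map_expoCov_compProd_lawOutc, integral_map hpair.aemeasurable hkm.aestronglyMeasurable]
    _ = ∫ p, ∫ y, k (p, y) ∂(lawOutc Q p) ∂(Q.map expoCov) := Measure.integral_compProd hki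
    _ = ∫ p, h p.1 p.2 * μ p.1 p.2 ∂(Q.map expoCov) := by
        refine integral_congr_ae ?_
        filter_upwards [hμ.mean] with p hp
        simp only [hk, hp]
        exact integral_const_mul _ _
    _ = ∫ z, h (expo z) (cov z) * μ (expo z) (cov z) ∂Q :=
        integral_map measurable_expoCov.aemeasurable (hh.mul hμ.measurable).aestronglyMeasurable

/-! ### Absolute deviations and medians. -/

lemma side_eq (y m : ℝ) : side y m = if m < y then 1 else if y < m then -1 else 0 := by
  unfold side
  rcases lt_trichotomy m y with h | rfl | h
  · simp [h, h.not_gt]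
  · simp
  · simp [h, h.not_gt]

/-- This identity turns the sensitivity term of the influence function into an absolute deviation,
which is 1-Lipschitz in the median and minimized in mean at the true one. -/
lemma sub_mul_side (y m : ℝ) : (y - m) * side y m = |y - m| := by
  rw [side_eq]
  rcases lt_trichotomy m y with h | rfl | h
  · simp [h, abs_of_pos (sub_pos.2 h)]
  · simp
  · simp [h, h.not_gt, abs_of_neg (sub_neg.2 h)]

lemma abs_side_le (y m : ℝ) : |side y m| ≤ 1 := by
  rw [side_eq]; split_ifs <;> simp

lemma measurable_side : Measurable fun p : ℝ × ℝ => side p.1 p.2 := by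
  simp only [side_eq]
  exact Measurable.ite (measurableSet_lt measurable_snd measurable_fst) measurable_const
    (Measurable.ite (measurableSet_lt measurable_fst measurable_snd) measurable_const
      measurable_const)

/-- Second-order expansion of the absolute deviation around `m`. -/
lemma abs_absDev_sub_le (y m m' : ℝ) :
    |(|y - m'| - |y - m|) - (m - m') * side y m| ≤
      (Set.uIcc m m').indicator (fun _ => 2 * |m' - m|) y := by
  rw [side_eq]
  have hmem : y ∈ Set.uIcc m m' ↔ (m ≤ y ∧ y ≤ m') ∨ (m' ≤ y ∧ y ≤ m) := Set.mem_uIcc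
  -- Between `m` and `m'` the deviation difference and the linear term are each at most `|m' - m|`,
  -- whence the factor 2. Outside that closed interval, `y` lies strictly on the same side of both
  -- points and the expansion is exact.
  by_cases hy : y ∈ Set.uIcc m m'
  · rw [Set.indicator_of_mem hy]
    have h1 : |(|y - m'| - |y - m|)| ≤ |m' - m| := by
      refine (abs_abs_sub_abs_le_abs_sub _ _).trans_eq ?_
      rw [show y - m' - (y - m) = -(m' - m) by ring, abs_neg]
    refine (abs_sub _ _).trans ?_
    have h2 : |(m - m') * (if m < y then 1 else if y < m then -1 else 0 : ℝ)| ≤ |m' - m| := by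
      rw [abs_mul, abs_sub_comm m m']
      refine mul_le_of_le_one_right (abs_nonneg _) ?_
      split_ifs <;> simp
    linarith
  · rw [Set.indicator_of_notMem hy]
    rw [hmem] at hy
    push Not at hy
    rcases lt_or_ge m y with h | h
    · have h' := hy.1 h.le
      rw [if_pos h, abs_of_pos (sub_pos.2 h), abs_of_pos (sub_pos.2 h')]
      simp
    · have hne : y ≠ m := by
        rintro rfl
        rcases le_total y m' with h'' | h''
        · exact absurd (hy.1 le_rfl) h''.not_gt
        · exact absurd (hy.2 h'') (lt_irrefl _)
      have hlt := lt_of_le_of_ne h hne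
      have h' : y < m' := by
        by_contra hcon
        exact absurd (hy.2 (not_lt.1 hcon)) h.not_gt
      rw [if_neg h.not_gt, if_pos hlt, abs_of_neg (sub_neg.2 hlt), abs_of_neg (sub_neg.2 h')]
      simp

section Median

variable {ν : Measure ℝ} [IsProbabilityMeasure ν]

lemma integrable_side (m : ℝ) : Integrable (fun y => side y m) ν :=
  Integrable.of_bound (measurable_side.comp (measurable_id.prodMk measurable_const)).aestronglyMeasurable
    1 (Eventually.of_forall fun y => abs_side_le y m)

/-- Without atoms the open and closed half-lines have the same mass, so the two median inequalities
force mass exactly 1/2 on each side. This is the first-order condition at the median. -/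
lemma integral_side_eq_zero [NullSingletonClass ν] {m : ℝ} (h1 : 1 / 2 ≤ ν (Set.Iic m))
    (h2 : 1 / 2 ≤ ν (Set.Ici m)) : ∫ y, side y m ∂ν = 0 := by
  have e1 : ∫ y, side y m ∂ν = ν.real (Set.Ioi m) - ν.real (Set.Iio m) := by
    unfold side
    rw [integral_sub, integral_indicator_one measurableSet_Ioi,
      integral_indicator_one measurableSet_Iio]
    · exact (integrable_const 1).indicator measurableSet_Ioi
    · exact (integrable_const 1).indicator measurableSet_Iio
  have r1 : ν.real (Set.Ioi m) = 1 - ν.real (Set.Iic m) := by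
    rw [← Set.compl_Iic, probReal_compl_eq_one_sub measurableSet_Iic]
  have r2 : ν.real (Set.Iio m) = 1 - ν.real (Set.Ici m) := by
    rw [← Set.compl_Ici, probReal_compl_eq_one_sub measurableSet_Ici]
  have r3 : ν.real (Set.Iio m) = ν.real (Set.Iic m) := measureReal_congr Iio_ae_eq_Iic
  have half : (1 / 2 : ℝ≥0∞).toReal = 1 / 2 := by simp
  have q1 : 1 / 2 ≤ ν.real (Set.Iic m) := by
    rw [← half]; exact ENNReal.toReal_mono (measure_ne_top _ _) h1
  have q2 : 1 / 2 ≤ ν.real (Set.Ici m) := by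
    rw [← half]; exact ENNReal.toReal_mono (measure_ne_top _ _) h2
  rw [e1]
  linarith

/-- The expected absolute deviation is minimal at a median, with a quadratic remainder when the
law has a bounded density. -/
lemma abs_integral_absDev_sub_le {g : ℝ → ℝ} {K : ℝ} (hK : ∀ y, g y ≤ K) (hK0 : 0 ≤ K)
    (hν : ν = volume.withDensity fun y => ENNReal.ofReal (g y)) {m : ℝ}
    (h1 : 1 / 2 ≤ ν (Set.Iic m)) (h2 : 1 / 2 ≤ ν (Set.Ici m)) (m' : ℝ) :
    |∫ y, (|y - m'| - |y - m|) ∂ν| ≤ 2 * K * (m' - m) ^ 2 := by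
  have hna : NullSingletonClass ν := by rw [hν]; infer_instance
  have hside := integral_side_eq_zero h1 h2
  have hint : Integrable (fun y => |y - m'| - |y - m|) ν := by
    refine Integrable.of_bound (by fun_prop) |m' - m| (Eventually.of_forall fun y => ?_)
    refine (abs_abs_sub_abs_le_abs_sub _ _).trans_eq ?_
    rw [show y - m' - (y - m) = -(m' - m) by ring, abs_neg]
  -- The second factor of `|m' - m|`: the density bound makes the interval where the expansion fails
  -- have small mass.
  have hmeas : ν.real (Set.uIcc m m') ≤ K * |m' - m| := by
    refine ENNReal.toReal_le_of_le_ofReal (by positivity) ?_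
    rw [hν, withDensity_apply _ measurableSet_uIcc]
    calc ∫⁻ y in Set.uIcc m m', ENNReal.ofReal (g y)
        ≤ ∫⁻ _ in Set.uIcc m m', ENNReal.ofReal K :=
          lintegral_mono fun y => ENNReal.ofReal_le_ofReal (hK y)
      _ = ENNReal.ofReal (K * |m' - m|) := by
          rw [setLIntegral_const, Real.volume_interval, ENNReal.ofReal_mul hK0]
  -- The linear term can be subtracted for free, since `side` has mean zero at the median.
  calc |∫ y, (|y - m'| - |y - m|) ∂ν|
      = |∫ y, ((|y - m'| - |y - m|) - (m - m') * side y m) ∂ν| := by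
        rw [integral_sub hint ((integrable_side m).const_mul _), integral_const_mul, hside]
        simp
    _ ≤ ∫ y, (Set.uIcc m m').indicator (fun _ => 2 * |m' - m|) y ∂ν :=
        (Real.norm_eq_abs _).symm.trans_le <| norm_integral_le_of_norm_le ((integrable_const _).indicator measurableSet_uIcc)
          (Eventually.of_forall fun y => abs_absDev_sub_le y m m')
    _ = ν.real (Set.uIcc m m') * (2 * |m' - m|) := by
        rw [integral_indicator_const _ measurableSet_uIcc, smul_eq_mul]
    _ ≤ K * |m' - m| * (2 * |m' - m|) := by gcongr
    _ = 2 * K * (m' - m) ^ 2 := by rw [← sq_abs (m' - m)]; ring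

end Median

/-- `E[M(A, X) (1{Y > M(A, X)} - 1{Y < M(A, X)})] = 0` at a conditional median. -/
lemma integral_median_mul_side {g : ℝ → ℝ → 𝒳 → ℝ} (hg : IsOutcomeDensity Q g)
    {M : ℝ → 𝒳 → ℝ} (hM : IsCondMedian Q M) {C : ℝ} (hb : ∀ᵐ z ∂Q, |M (expo z) (cov z)| ≤ C) :
    ∫ z, M (expo z) (cov z) * side (outc z) (M (expo z) (cov z)) ∂Q = 0 := by
  have hpair : Measurable fun z : Obs 𝒳 => (expoCov z, outc z) := by fun_prop
  set k : (ℝ × 𝒳) × ℝ → ℝ := fun p => M p.1.1 p.1.2 * side p.2 (M p.1.1 p.1.2) with hk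
  have hM1 : Measurable fun p : (ℝ × 𝒳) × ℝ => M p.1.1 p.1.2 := hM.measurable.comp measurable_fst
  have hkm : Measurable k := hM1.mul (measurable_side.comp (measurable_snd.prodMk hM1))
  have hki : Integrable k (Q.map expoCov ⊗ₘ lawOutc Q) := by
    rw [map_expoCov_compProd_lawOutc,
      integrable_map_measure hkm.aestronglyMeasurable hpair.aemeasurable]
    refine Integrable.of_bound (hkm.comp hpair).aestronglyMeasurable C ?_
    filter_upwards [hb] with z hz
    rw [Real.norm_eq_abs]
    refine (abs_mul _ _).trans_le ?_
    exact (mul_le_of_le_one_right (abs_nonneg _) (abs_side_le _ _)).trans hz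
  calc ∫ z, k (expoCov z, outc z) ∂Q
      = ∫ p, k p ∂(Q.map expoCov ⊗ₘ lawOutc Q) := by
        rw [map_expoCov_compProd_lawOutc, integral_map hpair.aemeasurable hkm.aestronglyMeasurable]
    _ = ∫ p, ∫ y, k (p, y) ∂(lawOutc Q p) ∂(Q.map expoCov) := Measure.integral_compProd hki
    _ = ∫ _, 0 ∂(Q.map expoCov) := by
        refine integral_congr_ae ?_
        filter_upwards [hM.median, hg.density] with p ⟨h1, h2⟩ hp
        have : NullSingletonClass (lawOutc Q p) := by rw [hp]; infer_instance
        simp only [hk]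
        rw [integral_const_mul, integral_side_eq_zero h1 h2, mul_zero]
    _ = 0 := by simp

/-- The expected absolute deviation from an approximate conditional median differs from the one
at the conditional median by a quadratic term. -/
lemma abs_integral_condAbsDev_sub_le {g : ℝ → ℝ → 𝒳 → ℝ} (hg : IsOutcomeDensity Q g) {K : ℝ}
    (hK : ∀ y a x, g y a x ≤ K) (hK0 : 0 ≤ K) {M : ℝ → 𝒳 → ℝ} (hM : IsCondMedian Q M)
    {m : ℝ → 𝒳 → ℝ} (hm : Measurable fun p : ℝ × 𝒳 => m p.1 p.2) {C : ℝ}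
    (hb : ∀ᵐ z ∂Q, |m (expo z) (cov z) - M (expo z) (cov z)| ≤ C) :
    |∫ z, (|outc z - m (expo z) (cov z)| - |outc z - M (expo z) (cov z)|) ∂Q| ≤
      2 * K * ∫ z, (m (expo z) (cov z) - M (expo z) (cov z)) ^ 2 ∂Q := by
  have hpair : Measurable fun z : Obs 𝒳 => (expoCov z, outc z) := by fun_prop
  set k : (ℝ × 𝒳) × ℝ → ℝ := fun p => |p.2 - m p.1.1 p.1.2| - |p.2 - M p.1.1 p.1.2| with hk
  have hM1 : Measurable fun p : (ℝ × 𝒳) × ℝ => M p.1.1 p.1.2 := hM.measurable.comp measurable_fst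
  have hm1 : Measurable fun p : (ℝ × 𝒳) × ℝ => m p.1.1 p.1.2 := hm.comp measurable_fst
  have hkm : Measurable k := (measurable_snd.sub hm1).abs.sub (measurable_snd.sub hM1).abs
  have hki : Integrable k (Q.map expoCov ⊗ₘ lawOutc Q) := by
    rw [map_expoCov_compProd_lawOutc,
      integrable_map_measure hkm.aestronglyMeasurable hpair.aemeasurable]
    refine Integrable.of_bound (hkm.comp hpair).aestronglyMeasurable C ?_
    filter_upwards [hb] with z hz
    refine (abs_abs_sub_abs_le_abs_sub _ _).trans ?_
    refine le_trans (le_of_eq ?_) hz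
    rw [abs_sub_comm (m _ _)]
    simp only [expoCov]
    congr 1
    ring
  have hdm : Measurable fun p : ℝ × 𝒳 => (m p.1 p.2 - M p.1 p.2) ^ 2 :=
    (hm.sub hM.measurable).pow_const 2
  have hdi : Integrable (fun p : ℝ × 𝒳 => (m p.1 p.2 - M p.1 p.2) ^ 2) (Q.map expoCov) := by
    rw [integrable_map_measure hdm.aestronglyMeasurable measurable_expoCov.aemeasurable]
    refine Integrable.of_bound (hdm.comp measurable_expoCov).aestronglyMeasurable (C ^ 2) ?_
    filter_upwards [hb] with z hz
    rw [Real.norm_eq_abs]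
    refine (abs_pow _ 2).trans_le ?_
    exact pow_le_pow_left₀ (abs_nonneg _) hz 2
  calc |∫ z, k (expoCov z, outc z) ∂Q|
      = |∫ p, k p ∂(Q.map expoCov ⊗ₘ lawOutc Q)| := by
        rw [map_expoCov_compProd_lawOutc, integral_map hpair.aemeasurable hkm.aestronglyMeasurable]
    _ = |∫ p, ∫ y, k (p, y) ∂(lawOutc Q p) ∂(Q.map expoCov)| := by
        rw [Measure.integral_compProd hki]
    _ ≤ ∫ p, 2 * K * (m p.1 p.2 - M p.1 p.2) ^ 2 ∂(Q.map expoCov) := by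
        refine (Real.norm_eq_abs _).symm.trans_le <| norm_integral_le_of_norm_le (hdi.const_mul _) ?_
        filter_upwards [hM.median, hg.density] with p ⟨h1, h2⟩ hp
        rw [Real.norm_eq_abs]
        exact abs_integral_absDev_sub_le (fun y => hK y p.1 p.2) hK0 hp h1 h2 (m p.1 p.2)
    _ = 2 * K * ∫ z, (m (expo z) (cov z) - M (expo z) (cov z)) ^ 2 ∂Q := by
        rw [integral_const_mul,
          integral_map measurable_expoCov.aemeasurable hdm.aestronglyMeasurable]
        rfl

end ADE

/-! ### The estimated influence function: L² error and bias. -/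

namespace ADE

/-- The pointwise squared error of the nuisances. -/
noncomputable def Nuisance.sqError {𝒳 : Type*} (ηhat η : Nuisance 𝒳) (z : Obs 𝒳) : ℝ :=
  (ηhat.mu (expo z) (cov z) - η.mu (expo z) (cov z)) ^ 2
    + (ηhat.dmu (expo z) (cov z) - η.dmu (expo z) (cov z)) ^ 2
    + (ηhat.s (expo z) (cov z) - η.s (expo z) (cov z)) ^ 2
    + (ηhat.M (expo z) (cov z) - η.M (expo z) (cov z)) ^ 2

lemma phiMax_eq {𝒳 : Type*} (γ : ℝ) (η : Nuisance 𝒳) (z : Obs 𝒳) :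
    phiMax γ η z = η.dmu (expo z) (cov z)
      - η.s (expo z) (cov z) * (outc z - η.mu (expo z) (cov z))
      + γ * |outc z - η.M (expo z) (cov z)| := by
  rw [phiMax, sub_mul_side]

/-- The squared error of the estimated influence function is controlled by that of the nuisances
and the tail of the outcome. -/
lemma sq_phiMax_sub_le {𝒳 : Type*} {γ C T : ℝ} {ηhat η : Nuisance 𝒳} {z : Obs 𝒳}
    (h1 : |ηhat.s (expo z) (cov z)| ≤ C) (h2 : |η.s (expo z) (cov z)| ≤ C)
    (h3 : |η.mu (expo z) (cov z)| ≤ C) :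
    (phiMax γ ηhat z - phiMax γ η z) ^ 2 ≤
      5 * (1 + T ^ 2 + 2 * C ^ 2 + γ ^ 2) * ηhat.sqError η z
        + 20 * C ^ 2 * {z : Obs 𝒳 | T < |outc z|}.indicator (fun z => outc z ^ 2) z := by
  have hC : 0 ≤ C := (abs_nonneg _).trans h1
  simp only [phiMax_eq, Nuisance.sqError]
  set a := ηhat.mu (expo z) (cov z)
  set b := η.mu (expo z) (cov z)
  set s := ηhat.s (expo z) (cov z)
  set t := η.s (expo z) (cov z)
  set d := ηhat.dmu (expo z) (cov z)
  set e := η.dmu (expo z) (cov z)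
  set m := ηhat.M (expo z) (cov z)
  set k := η.M (expo z) (cov z)
  set y := outc z
  set q := (a - b) ^ 2 + (d - e) ^ 2 + (s - t) ^ 2 + (m - k) ^ 2 with hq
  set I := {z : Obs 𝒳 | T < |outc z|}.indicator (fun z => outc z ^ 2) z
  have sum_sq (u v w x r : ℝ) :
      (u + v + w + x + r) ^ 2 ≤ 5 * (u ^ 2 + v ^ 2 + w ^ 2 + x ^ 2 + r ^ 2) := by
    nlinarith [sq_nonneg (u - v), sq_nonneg (u - w), sq_nonneg (u - x), sq_nonneg (u - r),
      sq_nonneg (v - w), sq_nonneg (v - x), sq_nonneg (v - r), sq_nonneg (w - x),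
      sq_nonneg (w - r), sq_nonneg (x - r)]
  have ha0 := sq_nonneg (a - b)
  have hd0 := sq_nonneg (d - e)
  have hs0 := sq_nonneg (s - t)
  have hm0 := sq_nonneg (m - k)
  have qa : (a - b) ^ 2 ≤ q := by rw [hq]; linarith
  have qs : (s - t) ^ 2 ≤ q := by rw [hq]; linarith
  have qd : (d - e) ^ 2 ≤ q := by rw [hq]; linarith
  have qm : (m - k) ^ 2 ≤ q := by rw [hq]; linarith
  have hs2 : s ^ 2 ≤ C ^ 2 := by rw [← sq_abs]; gcongr
  have hb2 : b ^ 2 ≤ C ^ 2 := by rw [← sq_abs]; gcongr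
  have hst : (s - t) ^ 2 ≤ 4 * C ^ 2 := by
    have : |s - t| ≤ 2 * C := (abs_sub _ _).trans (by linarith)
    rw [← sq_abs]
    calc |s - t| ^ 2 ≤ (2 * C) ^ 2 := by gcongr
      _ = 4 * C ^ 2 := by ring
  -- Truncation: for `|y| ≤ T` the outcome costs a factor `T ^ 2`; beyond `T` only boundedness of `s
  -- - t` is used, leaving the tail of `y ^ 2`.
  have p2 : (-((s - t) * y)) ^ 2 ≤ T ^ 2 * q + 4 * C ^ 2 * I := by
    rw [neg_sq, mul_pow]
    by_cases hy : T < |y|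
    · have : I = y ^ 2 := Set.indicator_of_mem (s := {z : Obs 𝒳 | T < |outc z|}) hy _
      rw [this]
      have := mul_le_mul_of_nonneg_right hst (sq_nonneg y)
      have : 0 ≤ T ^ 2 * q := mul_nonneg (sq_nonneg _) ((sq_nonneg _).trans qa)
      linarith
    · have : I = 0 := Set.indicator_of_notMem (s := {z : Obs 𝒳 | T < |outc z|}) hy _
      rw [this, mul_zero, add_zero, mul_comm]
      have hy2 : y ^ 2 ≤ T ^ 2 := by rw [← sq_abs]; gcongr; exact not_lt.1 hy
      exact mul_le_mul hy2 qs (sq_nonneg _) (sq_nonneg _)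
  have p3 : (s * (a - b)) ^ 2 ≤ C ^ 2 * q := by
    rw [mul_pow]; exact mul_le_mul hs2 qa (sq_nonneg _) (sq_nonneg _)
  have p4 : (b * (s - t)) ^ 2 ≤ C ^ 2 * q := by
    rw [mul_pow]; exact mul_le_mul hb2 qs (sq_nonneg _) (sq_nonneg _)
  have p5 : (γ * (|y - m| - |y - k|)) ^ 2 ≤ γ ^ 2 * q := by
    rw [mul_pow]
    refine mul_le_mul_of_nonneg_left (le_trans ?_ qm) (sq_nonneg _)
    rw [← sq_abs, ← sq_abs (m - k)]
    refine pow_le_pow_left₀ (abs_nonneg _) ((abs_abs_sub_abs_le_abs_sub _ _).trans_eq ?_) 2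
    rw [abs_sub_comm m k]; congr 1; ring
  -- Changing one nuisance at a time gives five increments. Cauchy–Schwarz contributes the factor 5,
  -- so the tail coefficient is `5 * 4 * C ^ 2`.
  have hsum : (d - s * (y - a) + γ * |y - m|) - (e - t * (y - b) + γ * |y - k|)
      = (d - e) + -((s - t) * y) + s * (a - b) + b * (s - t) + γ * (|y - m| - |y - k|) := by ring
  rw [hsum]
  refine (sum_sq _ _ _ _ _).trans ?_
  linarith

variable {𝒳 : Type*} [MeasurableSpace 𝒳]

/-- The nuisances are jointly measurable, and `μ` is differentiable in the exposure. -/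
structure Nuisance.IsRegular (η : Nuisance 𝒳) : Prop where
  measurable_mu : Measurable fun p : ℝ × 𝒳 => η.mu p.1 p.2
  measurable_s : Measurable fun p : ℝ × 𝒳 => η.s p.1 p.2
  measurable_M : Measurable fun p : ℝ × 𝒳 => η.M p.1 p.2
  differentiable_mu : ∀ x, Differentiable ℝ fun a => η.mu a x

lemma Nuisance.IsRegular.measurable_dmu {η : Nuisance 𝒳} (hη : η.IsRegular) :
    Measurable fun p : ℝ × 𝒳 => η.dmu p.1 p.2 :=
  measurable_uncurry_deriv hη.measurable_mu hη.differentiable_mu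

lemma measurable_comp_obs {h : ℝ → 𝒳 → ℝ} (hh : Measurable fun p : ℝ × 𝒳 => h p.1 p.2) :
    Measurable fun z : Obs 𝒳 => h (expo z) (cov z) :=
  hh.comp measurable_expoCov

lemma Nuisance.IsRegular.measurable_phiMax {η : Nuisance 𝒳} (hη : η.IsRegular) (γ : ℝ) :
    Measurable (phiMax γ η) := by
  have h1 := measurable_comp_obs hη.measurable_mu
  have h2 := measurable_comp_obs hη.measurable_dmu
  have h3 := measurable_comp_obs hη.measurable_s
  have h4 := measurable_comp_obs hη.measurable_M
  rw [funext (phiMax_eq γ η)]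
  fun_prop

variable {Q : Measure (Obs 𝒳)}

lemma l2Dist_sq (g h : ℝ → 𝒳 → ℝ) :
    l2Dist Q g h ^ 2
      = ∫⁻ z, ENNReal.ofReal ((g (expo z) (cov z) - h (expo z) (cov z)) ^ 2) ∂Q := by
  have := eLpNorm_nnreal_pow_eq_lintegral (μ := Q) (p := 2) two_ne_zero
    (f := fun z => g (expo z) (cov z) - h (expo z) (cov z))
  simp only [NNReal.coe_ofNat, ENNReal.rpow_ofNat, ENNReal.coe_ofNat] at this
  rw [l2Dist, this]
  refine lintegral_congr fun z => ?_
  rw [Real.enorm_eq_ofReal_abs, ← ENNReal.ofReal_pow (abs_nonneg _), sq_abs]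

lemma lintegral_sqError_le {ηhat η : Nuisance 𝒳} (hηhat : ηhat.IsRegular) (hη : η.IsRegular) :
    ∫⁻ z, ENNReal.ofReal (ηhat.sqError η z) ∂Q ≤ Nuisance.error Q ηhat η ^ 2 := by
  have msq {g h : ℝ → 𝒳 → ℝ} (hg : Measurable fun p : ℝ × 𝒳 => g p.1 p.2)
      (hh : Measurable fun p : ℝ × 𝒳 => h p.1 p.2) : Measurable fun z : Obs 𝒳 =>
      ENNReal.ofReal ((g (expo z) (cov z) - h (expo z) (cov z)) ^ 2) :=
    (((measurable_comp_obs hg).sub (measurable_comp_obs hh)).pow_const 2).ennreal_ofReal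
  have n1 := msq hηhat.measurable_mu hη.measurable_mu
  have n2 := msq hηhat.measurable_dmu hη.measurable_dmu
  have n3 := msq hηhat.measurable_s hη.measurable_s
  have h (z : Obs 𝒳) : ENNReal.ofReal (ηhat.sqError η z)
      = ENNReal.ofReal ((ηhat.mu (expo z) (cov z) - η.mu (expo z) (cov z)) ^ 2)
        + ENNReal.ofReal ((ηhat.dmu (expo z) (cov z) - η.dmu (expo z) (cov z)) ^ 2)
        + ENNReal.ofReal ((ηhat.s (expo z) (cov z) - η.s (expo z) (cov z)) ^ 2)
        + ENNReal.ofReal ((ηhat.M (expo z) (cov z) - η.M (expo z) (cov z)) ^ 2) := by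
    rw [Nuisance.sqError, ENNReal.ofReal_add (by positivity) (by positivity),
      ENNReal.ofReal_add (by positivity) (by positivity),
      ENNReal.ofReal_add (by positivity) (by positivity)]
  simp only [h]
  rw [lintegral_add_left ((n1.fun_add n2).fun_add n3), lintegral_add_left (n1.fun_add n2),
    lintegral_add_left n1, ← l2Dist_sq ηhat.mu η.mu, ← l2Dist_sq ηhat.dmu η.dmu,
    ← l2Dist_sq ηhat.s η.s, ← l2Dist_sq ηhat.M η.M, Nuisance.error]
  have add_sq_le (a b : ℝ≥0∞) : a ^ 2 + b ^ 2 ≤ (a + b) ^ 2 := by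
    rw [add_sq]
    exact add_le_add (le_self_add) le_rfl
  exact (add_le_add ((add_le_add (add_sq_le _ _) le_rfl).trans (add_sq_le _ _)) le_rfl).trans
    (add_sq_le _ _)

lemma Nuisance.BoundedBy.of_le {η : Nuisance 𝒳} {C C' : ℝ} (h : η.BoundedBy Q C) (hC : C ≤ C') :
    η.BoundedBy Q C' :=
  Eventually.mono h fun _ ⟨h1, h2, h3, h4⟩ =>
    ⟨h1.trans hC, h2.trans hC, h3.trans hC, h4.trans hC⟩

lemma memLp_of_abs_le [IsProbabilityMeasure Q] {k : Obs 𝒳 → ℝ} (hk : Measurable k) {C : ℝ}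
    (hb : ∀ᵐ z ∂Q, |k z| ≤ C) : MemLp k 2 Q :=
  MemLp.of_bound hk.aestronglyMeasurable C hb

lemma memLp_phiMax [IsProbabilityMeasure Q] (hY : MemLp outc 2 Q) {η : Nuisance 𝒳}
    (hη : η.IsRegular) {C : ℝ} (hb : η.BoundedBy Q C) (γ : ℝ) : MemLp (phiMax γ η) 2 Q := by
  have m1 := measurable_comp_obs hη.measurable_mu
  have m2 := measurable_comp_obs hη.measurable_dmu
  have m3 := measurable_comp_obs hη.measurable_s
  have m4 := measurable_comp_obs hη.measurable_M
  have b1 := memLp_of_abs_le m1 (hb.mono fun _ h => h.1)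
  have b2 := memLp_of_abs_le m2 (hb.mono fun _ h => h.2.1)
  have b4 := memLp_of_abs_le m4 (hb.mono fun _ h => h.2.2.2)
  have b3 : MemLp (fun z => η.s (expo z) (cov z) * (outc z - η.mu (expo z) (cov z))) 2 Q := by
    refine ((hY.sub b1).const_mul C).mono (m3.mul (measurable_outc.sub m1)).aestronglyMeasurable ?_
    filter_upwards [hb] with z ⟨_, _, h3, _⟩
    rw [norm_mul, norm_mul]
    exact mul_le_mul_of_nonneg_right (h3.trans (le_abs_self C)) (norm_nonneg _)
  rw [funext (phiMax_eq γ η)]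
  exact (b2.sub b3).add ((hY.sub b4).abs.const_mul γ)

/-- The bias of the one-step functional is quadratic in the error of the nuisances. -/
lemma abs_integral_phiMax_sub_psiMax_le [IsProbabilityMeasure Q] (hY : MemLp outc 2 Q)
    {f : ℝ → 𝒳 → ℝ} (hf : IsExposureDensity Q f) (hf_diff : ∀ x, Differentiable ℝ fun a => f a x)
    {g : ℝ → ℝ → 𝒳 → ℝ} (hg : IsOutcomeDensity Q g) {K : ℝ} (hK : ∀ y a x, g y a x ≤ K)
    (hK0 : 0 ≤ K) {μ M : ℝ → 𝒳 → ℝ} (hμ : IsCondMean Q μ)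
    (hM : IsCondMedian Q M) (hreg : Nuisance.IsRegular ⟨μ, score f, M⟩)
    {C : ℝ} (hb : Nuisance.BoundedBy ⟨μ, score f, M⟩ Q C)
    {ηhat : Nuisance 𝒳} (hηhat : ηhat.IsRegular) (hbhat : ηhat.BoundedBy Q C) (γ : ℝ) :
    |∫ z, phiMax γ ηhat z ∂Q - psiMax Q γ f M| ≤
      (1 + 2 * K * |γ|) * ∫ z, ηhat.sqError ⟨μ, score f, M⟩ z ∂Q := by
  set η : Nuisance 𝒳 := ⟨μ, score f, M⟩ with hη
  have hYi := hY.integrable one_le_two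
  have m1 := measurable_comp_obs hηhat.measurable_mu
  have m2 := measurable_comp_obs hηhat.measurable_dmu
  have m3 := measurable_comp_obs hηhat.measurable_s
  have m4 := measurable_comp_obs hηhat.measurable_M
  have e1 := measurable_comp_obs hμ.measurable
  have e3 := measurable_comp_obs (measurable_score hf.measurable hf_diff)
  have e4 := measurable_comp_obs hM.measurable
  have b1 := memLp_of_abs_le m1 (hbhat.mono fun _ h => h.1)
  have b2 := memLp_of_abs_le m2 (hbhat.mono fun _ h => h.2.1)
  have b3 := memLp_of_abs_le m3 (hbhat.mono fun _ h => h.2.2.1)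
  have b4 := memLp_of_abs_le m4 (hbhat.mono fun _ h => h.2.2.2)
  have c1 := memLp_of_abs_le e1 (hb.mono fun _ h => h.1)
  have c3 := memLp_of_abs_le e3 (hb.mono fun _ h => h.2.2.1)
  have c4 := memLp_of_abs_le e4 (hb.mono fun _ h => h.2.2.2)
  have hds : ∀ᵐ z ∂Q, |ηhat.s (expo z) (cov z) - score f (expo z) (cov z)| ≤ C + C := by
    filter_upwards [hb, hbhat] with z hz hz'
    exact (abs_sub _ _).trans (add_le_add hz'.2.2.1 hz.2.2.1)
  have hdM : ∀ᵐ z ∂Q, |ηhat.M (expo z) (cov z) - M (expo z) (cov z)| ≤ C + C := by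
    filter_upwards [hb, hbhat] with z hz hz'
    exact (abs_sub _ _).trans (add_le_add hz'.2.2.2 hz.2.2.2)
  have ms : Measurable fun z : Obs 𝒳 => side (outc z) (M (expo z) (cov z)) :=
    measurable_side.comp (measurable_outc.prodMk e4)
  have hside (z : Obs 𝒳) : ‖side (outc z) (M (expo z) (cov z))‖ ≤ 1 := abs_side_le _ _
  have i0 : Integrable (fun z => -score f (expo z) (cov z) * outc z) Q :=
    c3.neg.integrable_mul hY
  have i0' : Integrable (fun z => outc z * side (outc z) (M (expo z) (cov z))) Q :=
    hYi.mul_bdd ms.aestronglyMeasurable (Eventually.of_forall hside)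
  have i1 : Integrable (fun z => ηhat.dmu (expo z) (cov z)
      + score f (expo z) (cov z) * ηhat.mu (expo z) (cov z)) Q :=
    (b2.integrable one_le_two).add (c3.integrable_mul b1)
  have i2 : Integrable (fun z => (ηhat.s (expo z) (cov z) - score f (expo z) (cov z)) * outc z) Q :=
    (b3.sub c3).integrable_mul hY
  have i2' : Integrable (fun z => (ηhat.s (expo z) (cov z) - score f (expo z) (cov z))
      * μ (expo z) (cov z)) Q := (b3.sub c3).integrable_mul c1
  have i3 : Integrable (fun z => (ηhat.s (expo z) (cov z) - score f (expo z) (cov z))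
      * ηhat.mu (expo z) (cov z)) Q := (b3.sub c3).integrable_mul b1
  have i4 : Integrable (fun z => |outc z - ηhat.M (expo z) (cov z)|
      - |outc z - M (expo z) (cov z)|) Q :=
    ((hY.sub b4).abs.sub (hY.sub c4).abs).integrable one_le_two
  have i5 : Integrable (fun z => M (expo z) (cov z) * side (outc z) (M (expo z) (cov z))) Q :=
    (c4.integrable one_le_two).mul_bdd ms.aestronglyMeasurable (Eventually.of_forall hside)
  have t1 : ∫ z, (ηhat.dmu (expo z) (cov z)
      + score f (expo z) (cov z) * ηhat.mu (expo z) (cov z)) ∂Q = 0 := by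
    refine integral_deriv_add_score_mul hf hf_diff hηhat.measurable_mu hηhat.differentiable_mu
      (C := C) ?_
    filter_upwards [hb, hbhat] with z hz hz'
    exact ⟨hz'.1, hz'.2.1, hz.2.2.1⟩
  have t2 := integral_mul_outc hY hμ
    (h := fun a x => ηhat.s a x - score f a x)
    (hηhat.measurable_s.sub (measurable_score hf.measurable hf_diff)) hds
  have t4 := abs_integral_condAbsDev_sub_le hg hK hK0 hM hηhat.measurable_M hdM
  have t5 := integral_median_mul_side hg hM (hb.mono fun _ h => h.2.2.2)
  have hq : Integrable (ηhat.sqError η) Q :=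
    (((b1.sub c1).integrable_sq.add (b2.sub (memLp_of_abs_le
      (measurable_comp_obs hreg.measurable_dmu) (hb.mono fun _ h => h.2.1))).integrable_sq).add
      (b3.sub c3).integrable_sq).add (b4.sub c4).integrable_sq
  -- The first group integrates to `psiMax`. The rest is arranged so that integration by parts
  -- (`t1`), conditioning on (A, X) (`t2`) and the median condition (`t5`) each remove a first-order
  -- term.
  have hphi : ∫ z, phiMax γ ηhat z ∂Q = ∫ z, ((-score f (expo z) (cov z) * outc z
      + γ * (outc z * side (outc z) (M (expo z) (cov z))))
      + ((ηhat.dmu (expo z) (cov z) + score f (expo z) (cov z) * ηhat.mu (expo z) (cov z))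
        - (ηhat.s (expo z) (cov z) - score f (expo z) (cov z)) * outc z
        + (ηhat.s (expo z) (cov z) - score f (expo z) (cov z)) * ηhat.mu (expo z) (cov z)
        + γ * ((|outc z - ηhat.M (expo z) (cov z)| - |outc z - M (expo z) (cov z)|)
          - M (expo z) (cov z) * side (outc z) (M (expo z) (cov z))))) ∂Q := by
    refine integral_congr_ae (Eventually.of_forall fun z => ?_)
    simp only [phiMax_eq]
    rw [← sub_mul_side (outc z) (M (expo z) (cov z))]
    ring
  -- Exact bias: a product of two errors plus the excess absolute deviation.
  have hdiff : ∫ z, phiMax γ ηhat z ∂Q - psiMax Q γ f M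
      = ∫ z, (ηhat.s (expo z) (cov z) - score f (expo z) (cov z))
          * (ηhat.mu (expo z) (cov z) - μ (expo z) (cov z)) ∂Q
        + γ * ∫ z, (|outc z - ηhat.M (expo z) (cov z)| - |outc z - M (expo z) (cov z)|) ∂Q := by
    have i12 := i1.sub' i2
    have i123 := i12.fun_add i3
    have i45 := (i4.sub' i5).const_mul γ
    have i0γ := i0'.const_mul γ
    rw [hphi, integral_add (i0.fun_add i0γ) (i123.fun_add i45), integral_add i0 i0γ,
      integral_add i123 i45, integral_add i12 i3, integral_sub i1 i2, t1, t2,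
      integral_const_mul, integral_const_mul, integral_sub i4 i5, t5, psiMax]
    simp only [mul_sub]
    rw [integral_sub i3 i2']
    ring
  have hmul : |∫ z, (ηhat.s (expo z) (cov z) - score f (expo z) (cov z))
      * (ηhat.mu (expo z) (cov z) - μ (expo z) (cov z)) ∂Q| ≤ ∫ z, ηhat.sqError η z ∂Q := by
    refine (Real.norm_eq_abs _).symm.trans_le <| norm_integral_le_of_norm_le hq
      (Eventually.of_forall fun z => ?_)
    rw [Real.norm_eq_abs, abs_mul, Nuisance.sqError]
    have h1 := two_mul_le_add_sq |ηhat.s (expo z) (cov z) - score f (expo z) (cov z)|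
      |ηhat.mu (expo z) (cov z) - μ (expo z) (cov z)|
    rw [sq_abs, sq_abs] at h1
    have h2 := sq_nonneg (ηhat.s (expo z) (cov z) - score f (expo z) (cov z))
    have h3 := sq_nonneg (ηhat.mu (expo z) (cov z) - μ (expo z) (cov z))
    have h4 := sq_nonneg (ηhat.dmu (expo z) (cov z) - η.dmu (expo z) (cov z))
    have h5 := sq_nonneg (ηhat.M (expo z) (cov z) - η.M (expo z) (cov z))
    simp only [hη] at h4 h5 ⊢
    linarith
  have hMq : ∫ z, (ηhat.M (expo z) (cov z) - M (expo z) (cov z)) ^ 2 ∂Q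
      ≤ ∫ z, ηhat.sqError η z ∂Q :=
    integral_mono (b4.sub c4).integrable_sq hq fun z =>
      le_add_of_nonneg_left (by positivity)
  rw [hdiff]
  refine (abs_add_le _ _).trans ?_
  rw [abs_mul, add_mul, one_mul]
  refine add_le_add hmul ((mul_le_mul_of_nonneg_left t4 (abs_nonneg γ)).trans ?_)
  rw [mul_comm (2 * K) |γ|, mul_assoc |γ| (2 * K)]
  gcongr


end ADE

/-! ### From the nuisance rate to asymptotic normality. -/

namespace ADE

lemma sqError_nonneg {𝒳 : Type*} (ηhat η : Nuisance 𝒳) (z : Obs 𝒳) : 0 ≤ ηhat.sqError η z := by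
  unfold Nuisance.sqError; positivity

/-- Together with the analogous identities for `psiHatMin` and `psiMin`, this reduces the lower
bound to the upper bound at -γ. -/
lemma phiMin_eq_phiMax_neg {𝒳 : Type*} (γ : ℝ) (η : Nuisance 𝒳) : phiMin γ η = phiMax (-γ) η := by
  funext z
  rw [phiMin, phiMax]
  ring

lemma psiHatMin_eq_psiHatMax_neg {𝒳 : Type*} (γ : ℝ) (n : ℕ) (η : Nuisance 𝒳) (z : ℕ → Obs 𝒳) :
    psiHatMin γ n η z = psiHatMax (-γ) n η z := by
  rw [psiHatMin, psiHatMax, phiMin_eq_phiMax_neg]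

variable {𝒳 : Type*} [MeasurableSpace 𝒳] {Q : Measure (Obs 𝒳)}

/-- Dominated convergence with dominating function Y². It makes the truncation error in the L² bound
negligible although Y has only a second moment. -/
lemma tendsto_lintegral_tail (hY : MemLp outc 2 Q) :
    Tendsto (fun T : ℕ => ∫⁻ z, ENNReal.ofReal
      ({z : Obs 𝒳 | (T : ℝ) < |outc z|}.indicator (fun z => outc z ^ 2) z) ∂Q) atTop (𝓝 0) := by
  have h := tendsto_lintegral_of_dominated_convergence (μ := Q)
    (F := fun (T : ℕ) z => ENNReal.ofReal
      ({z : Obs 𝒳 | (T : ℝ) < |outc z|}.indicator (fun z => outc z ^ 2) z))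
    (f := fun _ => 0) (fun z => ENNReal.ofReal (outc z ^ 2)) ?_ ?_ ?_ ?_
  · simpa using h
  · intro T
    exact ((measurable_outc.pow_const 2).indicator
      (measurableSet_lt measurable_const measurable_outc.abs)).ennreal_ofReal
  · intro T
    exact Eventually.of_forall fun z => ENNReal.ofReal_le_ofReal
      (Set.indicator_le_self' (fun _ _ => sq_nonneg _) z)
  · exact ((lintegral_ofReal_ne_top_iff_integrable (hY.1.pow 2)
      (Eventually.of_forall fun _ => sq_nonneg _)).2 hY.integrable_sq)
  · refine Eventually.of_forall fun z => tendsto_const_nhds.congr' ?_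
    filter_upwards [eventually_ge_atTop ⌈|outc z|⌉₊] with T hT
    rw [Set.indicator_of_notMem, ENNReal.ofReal_zero]
    exact not_lt.2 (Nat.ceil_le.1 hT)

lemma measurable_sqError {ηhat η : Nuisance 𝒳} (hηhat : ηhat.IsRegular) (hη : η.IsRegular) :
    Measurable (ηhat.sqError η) := by
  have h1 := measurable_comp_obs hηhat.measurable_mu
  have h2 := measurable_comp_obs hηhat.measurable_dmu
  have h3 := measurable_comp_obs hηhat.measurable_s
  have h4 := measurable_comp_obs hηhat.measurable_M
  have k1 := measurable_comp_obs hη.measurable_mu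
  have k2 := measurable_comp_obs hη.measurable_dmu
  have k3 := measurable_comp_obs hη.measurable_s
  have k4 := measurable_comp_obs hη.measurable_M
  unfold Nuisance.sqError
  fun_prop

/-- Squaring the rate `n^{1/4}` gives exactly the √n that multiplies the bias. -/
lemma sqrt_mul_lintegral_sqError_le {ηhat η : Nuisance 𝒳} (hηhat : ηhat.IsRegular)
    (hη : η.IsRegular) {n : ℕ} {ε : ℝ}
    (h : ENNReal.ofReal ((n : ℝ) ^ (1 / 4 : ℝ)) * Nuisance.error Q ηhat η < ENNReal.ofReal ε) :
    ENNReal.ofReal √n * ∫⁻ z, ENNReal.ofReal (ηhat.sqError η z) ∂Q ≤ ENNReal.ofReal (ε ^ 2) := by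
  have hε : 0 < ε := ENNReal.ofReal_pos.1 (pos_of_gt h)
  have hr : √(n : ℝ) = ((n : ℝ) ^ (1 / 4 : ℝ)) ^ 2 := by
    rw [Real.sqrt_eq_rpow, ← Real.rpow_natCast, ← Real.rpow_mul (Nat.cast_nonneg n)]
    norm_num
  rw [hr, ENNReal.ofReal_pow (by positivity), ENNReal.ofReal_pow hε.le]
  calc _ ≤ ENNReal.ofReal ((n : ℝ) ^ (1 / 4 : ℝ)) ^ 2 * Nuisance.error Q ηhat η ^ 2 := by
        gcongr
        exact lintegral_sqError_le hηhat hη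
    _ = (ENNReal.ofReal ((n : ℝ) ^ (1 / 4 : ℝ)) * Nuisance.error Q ηhat η) ^ 2 := by
        rw [mul_pow]
    _ ≤ _ := by gcongr

lemma lintegral_sq_phiMax_sub_le {γ C T : ℝ} {ηhat η : Nuisance 𝒳}
    (hηhat : ηhat.IsRegular) (hη : η.IsRegular) (hbhat : ηhat.BoundedBy Q C)
    (hb : η.BoundedBy Q C) :
    ∫⁻ z, ENNReal.ofReal ((phiMax γ ηhat z - phiMax γ η z) ^ 2) ∂Q ≤
      ENNReal.ofReal (5 * (1 + T ^ 2 + 2 * C ^ 2 + γ ^ 2))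
          * ∫⁻ z, ENNReal.ofReal (ηhat.sqError η z) ∂Q
        + ENNReal.ofReal (20 * C ^ 2) * ∫⁻ z, ENNReal.ofReal
          ({z : Obs 𝒳 | T < |outc z|}.indicator (fun z => outc z ^ 2) z) ∂Q := by
  have hm := (measurable_sqError hηhat hη).ennreal_ofReal
  rw [← lintegral_const_mul' _ _ ENNReal.ofReal_ne_top,
    ← lintegral_const_mul' _ _ ENNReal.ofReal_ne_top, ← lintegral_add_left (hm.const_mul _)]
  refine lintegral_mono_ae ?_
  filter_upwards [hb, hbhat] with z hz hz'
  rw [← ENNReal.ofReal_mul (by positivity), ← ENNReal.ofReal_mul (by positivity),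
    ← ENNReal.ofReal_add]
  · exact ENNReal.ofReal_le_ofReal (sq_phiMax_sub_le hz'.2.2.1 hz.2.2.1 hz.1)
  · exact mul_nonneg (by positivity) (sqError_nonneg _ _ _)
  · exact mul_nonneg (by positivity) (Set.indicator_nonneg (fun _ _ => sq_nonneg _) _)

lemma IsLearner.isRegular {𝒯 : Type*} [MeasurableSpace 𝒯] {ηhat : 𝒯 → Nuisance 𝒳}
    (h : IsLearner ηhat) (t : 𝒯) : (ηhat t).IsRegular where
  measurable_mu := h.measurable_mu.comp measurable_prodMk_left
  measurable_s := h.measurable_s.comp measurable_prodMk_left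
  measurable_M := h.measurable_M.comp measurable_prodMk_left
  differentiable_mu := h.differentiable_mu t

lemma IsLearner.measurable_phiMax {𝒯 : Type*} [MeasurableSpace 𝒯] {ηhat : 𝒯 → Nuisance 𝒳}
    (h : IsLearner ηhat) (γ : ℝ) :
    Measurable fun p : 𝒯 × Obs 𝒳 => phiMax γ (ηhat p.1) p.2 := by
  have hp : Measurable fun p : 𝒯 × Obs 𝒳 => (p.1, expo p.2, cov p.2) := by fun_prop
  have h1 := h.measurable_mu.comp hp
  have h3 := h.measurable_s.comp hp
  have h4 := h.measurable_M.comp hp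
  have h2 : Measurable fun p : 𝒯 × Obs 𝒳 => (ηhat p.1).dmu (expo p.2) (cov p.2) := by
    have hd := measurable_deriv_param (α := 𝒯 × 𝒳) (h := fun q a => (ηhat q.1).mu a q.2)
      (h.measurable_mu.comp (f := fun p : (𝒯 × 𝒳) × ℝ => (p.1.1, p.2, p.1.2)) (by fun_prop))
      fun q => h.differentiable_mu q.1 q.2
    exact hd.comp (f := fun p : 𝒯 × Obs 𝒳 => ((p.1, cov p.2), expo p.2)) (by fun_prop)
  have h5 : Measurable fun p : 𝒯 × Obs 𝒳 => outc p.2 := by fun_prop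
  simp only [phiMax_eq]
  exact (h2.sub (h3.mul (h5.sub h1))).add ((h5.sub h4).abs.const_mul γ)

lemma psiMin_eq_psiMax_neg (γ : ℝ) (f M : ℝ → 𝒳 → ℝ) : psiMin Q γ f M = psiMax Q (-γ) f M := by
  rw [psiMin, psiMax]
  ring

/-- Asymptotic normality of the one-step estimator, for a sensitivity parameter of any sign. -/
theorem tendstoInDistribution_psiHatMax {Ω : Type*} [MeasurableSpace Ω]
    [IsProbabilityMeasure Q] (hY : MemLp outc 2 Q) (γ : ℝ)
    {f : ℝ → 𝒳 → ℝ} (hf : IsExposureDensity Q f) (hf_diff : ∀ x, Differentiable ℝ fun a => f a x)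
    {g : ℝ → ℝ → 𝒳 → ℝ} (hg : IsOutcomeDensity Q g) (hg_bdd : ∃ C : ℝ, ∀ y a x, g y a x ≤ C)
    {μ : ℝ → 𝒳 → ℝ} (hμ : IsCondMean Q μ) (hμ_diff : ∀ x, Differentiable ℝ fun a => μ a x)
    {M : ℝ → 𝒳 → ℝ} (hM : IsCondMedian Q M)
    (hη_bdd : ∃ C : ℝ, Nuisance.BoundedBy ⟨μ, score f, M⟩ Q C)
    {P : Measure Ω} [IsProbabilityMeasure P]
    {Z : ℕ → Ω → Obs 𝒳} (hZ_law : ∀ i, HasLaw (Z i) Q P) (hZ_indep : iIndepFun Z P)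
    {𝒯 : ℕ → Type*} [∀ n, MeasurableSpace (𝒯 n)]
    {W : ∀ n, Ω → 𝒯 n} (hW : ∀ n, AEMeasurable (W n) P)
    (hW_indep : ∀ n, IndepFun (W n) (fun ω (i : Fin n) => Z i ω) P)
    {ηhat : ∀ n, 𝒯 n → Nuisance 𝒳} (hηhat : ∀ n, IsLearner (ηhat n))
    (hηhat_bdd : ∃ C : ℝ, ∀ n, ∀ᵐ ω ∂P, (ηhat n (W n ω)).BoundedBy Q C)
    (hrate : IsLittleOP P
      (fun n ω => Nuisance.error Q (ηhat n (W n ω)) ⟨μ, score f, M⟩) (1 / 4)) :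
    TendstoInDistribution
      (fun (n : ℕ) ω => √(n : ℝ) *
        (psiHatMax γ n (ηhat n (W n ω)) (fun i => Z i ω) - psiMax Q γ f M))
      atTop (id : ℝ → ℝ) (fun _ => P)
      (gaussianReal 0 (variance (phiMax γ ⟨μ, score f, M⟩) Q).toNNReal) := by
  set η : Nuisance 𝒳 := ⟨μ, score f, M⟩ with hη
  have hreg : η.IsRegular := ⟨hμ.measurable, measurable_score hf.measurable hf_diff,
    hM.measurable, hμ_diff⟩
  obtain ⟨K, hK⟩ : ∃ K : ℝ, 0 ≤ K ∧ ∀ y a x, g y a x ≤ K := by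
    obtain ⟨C, hC⟩ := hg_bdd
    exact ⟨max C 0, le_max_right _ _, fun y a x => (hC y a x).trans (le_max_left _ _)⟩
  obtain ⟨C, hb, hbhat⟩ : ∃ C : ℝ, η.BoundedBy Q C ∧
      ∀ n, ∀ᵐ ω ∂P, (ηhat n (W n ω)).BoundedBy Q C := by
    obtain ⟨C₁, h₁⟩ := hη_bdd
    obtain ⟨C₂, h₂⟩ := hηhat_bdd
    exact ⟨max C₁ C₂, h₁.of_le (le_max_left _ _),
      fun n => (h₂ n).mono fun ω h => h.of_le (le_max_right _ _)⟩
  have hbias {ηt : Nuisance 𝒳} (h1 : ηt.IsRegular) (h2 : ηt.BoundedBy Q C) :=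
    abs_integral_phiMax_sub_psiMax_le hY hf hf_diff hg hK.2 hK.1 hμ hM hreg hb h1 h2 γ
  -- Taking `ηhat = η` in the bias bound makes its right side 0, so the influence function has mean
  -- `psiMax`.
  have hmean : ∫ z, phiMax γ η z ∂Q = psiMax Q γ f M := by
    have h : _ ≤ _ * ∫ z, η.sqError η z ∂Q := hbias hreg hb
    have h0 : ∫ z, η.sqError η z ∂Q = 0 := by simp [Nuisance.sqError]
    rw [h0, mul_zero] at h
    exact sub_eq_zero.1 (abs_nonpos_iff.1 h)
  have hsmall (ε : ℝ) (hε : 0 < ε) : Tendsto (fun n : ℕ => P {ω | ENNReal.ofReal ε ≤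
      ENNReal.ofReal ((n : ℝ) ^ (1 / 4 : ℝ)) * Nuisance.error Q (ηhat n (W n ω)) η}) atTop (𝓝 0) :=
    hrate _ (ENNReal.ofReal_pos.2 hε)
  rw [← hmean]
  refine tendstoInDistribution_sampleSplit hZ_law hZ_indep hW hW_indep
    (hreg.measurable_phiMax γ) (memLp_phiMax hY hreg hb γ) (φhat := fun n t => phiMax γ (ηhat n t))
    (fun n => (hηhat n).measurable_phiMax γ) ?_ ?_
  · intro ε hε
    set e : ℝ := (min ε 1).toReal with he
    have hmt : min ε 1 ≠ ∞ := ((min_le_right _ _).trans_lt ENNReal.one_lt_top).ne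
    have he0 : 0 < e := ENNReal.toReal_pos (lt_min hε one_pos).ne' hmt
    have hee : ENNReal.ofReal e ≤ ε := by
      rw [he, ENNReal.ofReal_toReal hmt]; exact min_le_left _ _
    -- The truncation level is fixed first, independently of `n`, so that the tail takes half of
    -- `e`; the nuisance error then only has to beat the constant `A`, which depends on `T`.
    obtain ⟨T, hT⟩ : ∃ T : ℕ, ENNReal.ofReal (20 * C ^ 2) * ∫⁻ z, ENNReal.ofReal
        ({z : Obs 𝒳 | (T : ℝ) < |outc z|}.indicator (fun z => outc z ^ 2) z) ∂Q
        ≤ ENNReal.ofReal (e / 2) := by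
      have h := ENNReal.Tendsto.const_mul (a := ENNReal.ofReal (20 * C ^ 2))
        (tendsto_lintegral_tail hY) (Or.inr ENNReal.ofReal_ne_top)
      rw [mul_zero] at h
      exact (ENNReal.tendsto_nhds_zero.1 h _ (ENNReal.ofReal_pos.2 (half_pos he0))).exists
    set A : ℝ := 5 * (1 + (T : ℝ) ^ 2 + 2 * C ^ 2 + γ ^ 2) with hA
    have hA0 : 0 < A := by positivity
    -- The threshold is such that `A` times its square is `e / 2`. Requiring `n ≥ 1` allows the
    -- factor √n in the rate bound to be dropped.
    refine tendsto_of_tendsto_of_tendsto_of_le_of_le' tendsto_const_nhds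
      (hsmall √(e / 2 / A) (by positivity)) (Eventually.of_forall fun _ => zero_le) ?_
    filter_upwards [eventually_ge_atTop 1] with n hn
    refine measure_mono_ae ?_
    filter_upwards [hbhat n] with ω hω hlt
    by_contra hcon
    replace hcon := sqrt_mul_lintegral_sqError_le ((hηhat n).isRegular _) hreg (not_le.1 hcon)
    rw [Real.sq_sqrt (by positivity)] at hcon
    have h1 : (1 : ℝ≥0∞) ≤ ENNReal.ofReal √n := by
      rw [ENNReal.one_le_ofReal, Real.one_le_sqrt]
      exact_mod_cast hn
    refine absurd hlt (not_lt.2 (le_trans ?_ hee))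
    calc _ ≤ _ := lintegral_sq_phiMax_sub_le (T := T) ((hηhat n).isRegular _) hreg hω hb
      _ ≤ ENNReal.ofReal A * ENNReal.ofReal (e / 2 / A) + ENNReal.ofReal (e / 2) := by
          refine add_le_add (mul_le_mul_right ?_ _) hT
          exact (le_mul_of_one_le_left zero_le h1).trans hcon
      _ = ENNReal.ofReal e := by
          rw [← ENNReal.ofReal_mul hA0.le, mul_div_cancel₀ _ hA0.ne',
            ← ENNReal.ofReal_add (by positivity) (by positivity), add_halves]
  · intro δ hδ
    set D : ℝ := 1 + 2 * K * |γ| with hD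
    have hD0 : 0 < D := by have := hK.1; positivity
    -- Below this threshold the scaled bias is at most `D * (δ / 2 / D) = δ / 2`, which contradicts
    -- its being at least `δ`.
    refine tendsto_of_tendsto_of_tendsto_of_le_of_le tendsto_const_nhds
      (hsmall √(δ / 2 / D) (by positivity)) (fun _ => zero_le) fun n => measure_mono_ae ?_
    filter_upwards [hbhat n] with ω hω hle
    by_contra hcon
    have hregn := (hηhat n).isRegular (W n ω)
    replace hcon := sqrt_mul_lintegral_sqError_le hregn hreg (not_le.1 hcon)
    rw [Real.sq_sqrt (by positivity)] at hcon
    have hq : √(n : ℝ) * ∫ z, (ηhat n (W n ω)).sqError η z ∂Q ≤ δ / 2 / D := by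
      rw [integral_eq_lintegral_of_nonneg_ae (Eventually.of_forall (sqError_nonneg _ _))
        (measurable_sqError hregn hreg).aestronglyMeasurable]
      have := ENNReal.toReal_mono ENNReal.ofReal_ne_top hcon
      rwa [ENNReal.toReal_mul, ENNReal.toReal_ofReal (Real.sqrt_nonneg _),
        ENNReal.toReal_ofReal (by positivity)] at this
    have hle' : δ ≤ √(n : ℝ) * (D * ∫ z, (ηhat n (W n ω)).sqError η z ∂Q) := by
      refine (show δ ≤ |√(n : ℝ) * _| from hle).trans ?_
      rw [abs_mul, abs_of_nonneg (Real.sqrt_nonneg _), hmean]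
      exact mul_le_mul_of_nonneg_left (hbias hregn hω) (Real.sqrt_nonneg _)
    have := mul_le_mul_of_nonneg_left hq hD0.le
    rw [mul_div_cancel₀ _ hD0.ne'] at this
    linarith

end ADE

theorem mainTheorem1
    {𝒳 Ω : Type*} [MeasurableSpace 𝒳] [MeasurableSpace Ω]
    -- law of one observation `(X, A, Y)`, with outcome of finite second moment
    (Q : Measure (ADE.Obs 𝒳)) [IsProbabilityMeasure Q]
    (hY : MemLp ADE.outc 2 Q)
    -- sensitivity parameter
    (γ : ℝ) (hγ : 0 ≤ γ)
    -- conditional density of the exposure, differentiable in the exposure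
    (f : ℝ → 𝒳 → ℝ) (hf : ADE.IsExposureDensity Q f)
    (hf_diff : ∀ x, Differentiable ℝ (fun a => f a x))
    -- uniformly bounded conditional density of the outcome
    (g : ℝ → ℝ → 𝒳 → ℝ) (hg : ADE.IsOutcomeDensity Q g)
    (hg_bdd : ∃ C : ℝ, ∀ y a x, g y a x ≤ C)
    -- regression function, differentiable in the exposure, and conditional median
    (μ : ℝ → 𝒳 → ℝ) (hμ : ADE.IsCondMean Q μ)
    (hμ_diff : ∀ x, Differentiable ℝ (fun a => μ a x))
    (M : ℝ → 𝒳 → ℝ) (hM : ADE.IsCondMedian Q M)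
    -- the true nuisances and their almost sure boundedness
    (η : ADE.Nuisance 𝒳) (hη : η = ⟨μ, ADE.score f, M⟩)
    (hη_bdd : ∃ C : ℝ, η.BoundedBy Q C)
    -- i.i.d. evaluation sample
    (P : Measure Ω) [IsProbabilityMeasure P]
    (Z : ℕ → Ω → ADE.Obs 𝒳) (hZ_law : ∀ i, HasLaw (Z i) Q P) (hZ_indep : iIndepFun Z P)
    -- training data, independent of the evaluation sample of size `n`
    {𝒯 : ℕ → Type*} [∀ n, MeasurableSpace (𝒯 n)]
    (W : ∀ n, Ω → 𝒯 n) (hW : ∀ n, AEMeasurable (W n) P)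
    (hW_indep : ∀ n, IndepFun (W n) (fun ω (i : Fin n) => Z i ω) P)
    -- nuisance estimates, almost surely bounded by a common constant, with error `o_p(n^{-1/4})`
    (ηhat : ∀ n, 𝒯 n → ADE.Nuisance 𝒳) (hηhat : ∀ n, ADE.IsLearner (ηhat n))
    (hηhat_bdd : ∃ C : ℝ, ∀ n, ∀ᵐ ω ∂P, (ηhat n (W n ω)).BoundedBy Q C)
    (hrate : ADE.IsLittleOP P (fun n ω => ADE.Nuisance.error Q (ηhat n (W n ω)) η) (1 / 4)) :
    TendstoInDistribution
      (fun (n : ℕ) ω => √(n : ℝ) *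
        (ADE.psiHatMax γ n (ηhat n (W n ω)) (fun i => Z i ω) - ADE.psiMax Q γ f M))
      atTop (id : ℝ → ℝ) (fun _ => P)
      (gaussianReal 0 (variance (ADE.phiMax γ η) Q).toNNReal) ∧
    TendstoInDistribution
      (fun (n : ℕ) ω => √(n : ℝ) *
        (ADE.psiHatMin γ n (ηhat n (W n ω)) (fun i => Z i ω) - ADE.psiMin Q γ f M))
      atTop (id : ℝ → ℝ) (fun _ => P)
      (gaussianReal 0 (variance (ADE.phiMin γ η) Q).toNNReal) := by
  subst hη
  have key (γ' : ℝ) := ADE.tendstoInDistribution_psiHatMax hY γ' hf hf_diff hg hg_bdd hμ hμ_diff hM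
    hη_bdd hZ_law hZ_indep hW hW_indep hηhat hηhat_bdd hrate
  refine ⟨key γ, ?_⟩
  simp only [ADE.phiMin_eq_phiMax_neg, ADE.psiMin_eq_psiMax_neg, ADE.psiHatMin_eq_psiHatMax_neg]
  exact key (-γ)
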